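/- **Theorem.** Let $p$ be a prime, $N\ge 4$, $T=\{2,\dots,N-2\}$ and $D=N(N-3)/2$. Let $\mathbb{C}^D$ be the space of vectors $\boldsymbol{s}$ with coordinates $s_{1i}$, $s_{(N-1)i}$ ($i\in T$) and $s_{ij}$ ($2\le i<j\le N-2$). Put $$F(\boldsymbol{s},\boldsymbol{x})=\prod_{i=2}^{N-2}|x_i|_p^{s_{1i}}\,|1-x_i|_p^{s_{(N-1)i}}\prod_{2\le i<j\le N-2}|x_i-x_j|_p^{s_{ij}},\qquad Z^{(N)}(\boldsymbol{s})=\int_{\mathbb{Q}_p^{N-3}\smallsetminus\Lambda}F(\boldsymbol{s},\boldsymbol{x})\prod_{i=2}^{N-2}dx_i,$$ where $\Lambda=\{\boldsymbol{x}\in\mathbb{Q}_p^{N-3}:\ \prod_{i}x_i(1-x_i)\prod_{i<j}(x_i-x_j)=0\}$ and $dx_i$ is the Haar measure of $\mathbb{Q}_p$ with $\int_{\mathbb{Z}_p}dx=1$. Let $H(\mathbb{C})\subset\mathbb{C}^D$ be the set of all $\boldsymbol{s}$ such that * (C1) $|J|+\sum_{i\in J}\operatorname{Re}(s_{1i}+s_{(N-1)i})+\sum_{i<j,\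 i\in J}\operatorname{Re}(s_{ij})+\sum_{i<j,\ i\in T\smallsetminus J,\ j\in J}\operatorname{Re}(s_{ij})<0$ for all $\varnothing\ne J\subseteq T$; * (C2, C5) $|K|-1+\sum_{i<j,\ i,j\in K}\operatorname{Re}(s_{ij})>0$ for all $K\subseteq T$ with $|K|\ge2$; * (C4) $|J|+\sum_{i\in J}\operatorname{Re}(s_{ti})+\sum_{i<j,\ i,j\in J}\operatorname{Re}(s_{ij})>0$ for all $\varnothing\ne J\subseteq T$ and $t\in\{1,N-1\}$; * (C3, C6) $1+\operatorname{Re}(s)>0$ for every coordinate $s$ of $\boldsymbol{s}$, where $i,j$ run over $T$ in all the sums. (1) $H(\mathbb{C})$ is a non-empty open connected subset of $\mathbb{C}^D$; for $\boldsymbol{s}\in H(\mathbb{C})$ the integral $Z^{(N)}(\boldsymbol{s})$ converges absolutely, and it is a holomorphic function of $\boldsymbol{s}$ on $H(\mathbb{C})$. It has an analytic continuation to $\mathbb{C}^D$ as a rational function (with rational coefficients) of the variables $p^{-s}$, $s$ running over the coordinates of $\boldsymbol{s}$: there are polynomials $P,Q$ with rational coefficients such that $Q((p^{-s_{ij}}))\ne0$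 and $Z^{(N)}(\boldsymbol{s})=P((p^{-s_{ij}}))/Q((p^{-s_{ij}}))$ on $H(\mathbb{C})$. If $\boldsymbol{s}$ is a pole of this continuation (a point near which it does not extend holomorphically), then $\operatorname{Re}(\boldsymbol{s})\in\mathbb{R}^D$ lies on one of the finitely many hyperplanes obtained from (C1)–(C6) by replacing the signs $<$, $>$ by $=$. (2) If $\operatorname{Re}(s)\ge0$ for every coordinate $s$ of $\boldsymbol{s}\in\mathbb{C}^D$, then $\int_{\mathbb{Q}_p^{N-3}\smallsetminus\Lambda}|F(\boldsymbol{s},\boldsymbol{x})|\prod_i dx_i=+\infty$; in particular, for real $\boldsymbol{s}$ with non-negative coordinates the integral $Z^{(N)}(\boldsymbol{s})$ diverges to $+\infty$. -/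

import Mathlib

open MeasureTheory Topology Filter

/-! ## Haar measure on `ℚ_p` and on `ℚ_p^{N-3}` -/

/-- `ℚ_p` with its Borel `σ`-algebra. -/
noncomputable instance padicMeasurableSpace (p : ℕ) [Fact p.Prime] : MeasurableSpace ℚ_[p] := borel _

instance padicBorelSpace (p : ℕ) [Fact p.Prime] : BorelSpace ℚ_[p] := ⟨rfl⟩

/-- The unit ball `ℤ_p = {x : |x|_p ≤ 1}`, as a compact set with non-empty interior. -/
noncomputable def padicUnitBall (p : ℕ) [Fact p.Prime] : TopologicalSpace.PositiveCompacts ℚ_[p] where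
  carrier := Metric.closedBall 0 1
  isCompact' := isCompact_closedBall 0 1
  interior_nonempty' :=
    ⟨0, Metric.ball_subset_interior_closedBall (Metric.mem_ball_self one_pos)⟩

/-- The Haar measure of `(ℚ_p, +)`, normalized by giving `ℤ_p` measure `1`. -/
noncomputable def padicHaar (p : ℕ) [Fact p.Prime] : Measure ℚ_[p] :=
  Measure.addHaarMeasure (padicUnitBall p)

namespace StringZeta

/-- `T = {2, …, N-2}`. -/
abbrev T (N : ℕ) : Type := {i : ℕ // i ∈ Finset.Icc 2 (N - 2)}

/-- The pairs `(i, j)` with `2 ≤ i < j ≤ N-2`. -/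
abbrev Pair (N : ℕ) : Type := {e : T N × T N // e.1 < e.2}

/-- The index set of the variables: `s_{1i}` (`i ∈ T`), `s_{(N-1)i}` (`i ∈ T`), and
`s_{ij}` (`2 ≤ i < j ≤ N-2`). It has `D = N(N-3)/2` elements, so that `Var N → ℂ` is `ℂ^D`. -/
abbrev Var (N : ℕ) : Type := T N ⊕ T N ⊕ Pair N

/-- The index of `s_{1i}`. -/
abbrev Var.first {N : ℕ} (i : T N) : Var N := Sum.inl i

/-- The index of `s_{(N-1)i}`. -/
abbrev Var.last {N : ℕ} (i : T N) : Var N := Sum.inr (Sum.inl i)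

/-- The index of `s_{ij}`, `2 ≤ i < j ≤ N-2`. -/
abbrev Var.pair {N : ℕ} (e : Pair N) : Var N := Sum.inr (Sum.inr e)

/-- The product of the normalized Haar measures on `ℚ_p^{N-3}`. -/
noncomputable def haar (p : ℕ) [Fact p.Prime] (N : ℕ) : Measure (T N → ℚ_[p]) :=
  Measure.pi fun _ => padicHaar p

/-- The divisor `Λ`. -/
def divisor (p : ℕ) [Fact p.Prime] (N : ℕ) : Set (T N → ℚ_[p]) :=
  {x | (∏ i : T N, x i * (1 - x i)) * ∏ e : Pair N, (x e.1.1 - x e.1.2) = 0}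

/-- The integrand
`F(s, x) = ∏ᵢ |xᵢ|^{s_{1i}} |1 - xᵢ|^{s_{(N-1)i}} ∏_{i<j} |xᵢ - xⱼ|^{s_{ij}}`. -/
noncomputable def integrand (p : ℕ) [Fact p.Prime] (N : ℕ) (s : Var N → ℂ)
    (x : T N → ℚ_[p]) : ℂ :=
  (∏ i : T N, ((‖x i‖ : ℝ) : ℂ) ^ s (Var.first i) * ((‖1 - x i‖ : ℝ) : ℂ) ^ s (Var.last i)) *
    ∏ e : Pair N, ((‖x e.1.1 - x e.1.2‖ : ℝ) : ℂ) ^ s (Var.pair e)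

/-- The integral `Z^{(N)}(s)` over `ℚ_p^{N-3} ∖ Λ`. -/
noncomputable def zeta (p : ℕ) [Fact p.Prime] (N : ℕ) (s : Var N → ℂ) : ℂ :=
  ∫ x in (divisor p N)ᶜ, integrand p N s x ∂(haar p N)

/-! ## The linear conditions

Below `σ` stands for the vector of the real parts `Re(s_{ij})`. -/

/-- C1: `|J| + ∑_{i∈J} (σ_{1i} + σ_{(N-1)i}) + ∑_{i<j, i∈J} σ_{ij} + ∑_{i<j, i∉J, j∈J} σ_{ij}`. -/
noncomputable def formC1 {N : ℕ} (J : Finset (T N)) (σ : Var N → ℝ) : ℝ :=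
  (J.card : ℝ) + ∑ i ∈ J, (σ (Var.first i) + σ (Var.last i))
    + ∑ e : Pair N with e.1.1 ∈ J, σ (Var.pair e)
    + ∑ e : Pair N with e.1.1 ∉ J ∧ e.1.2 ∈ J, σ (Var.pair e)

/-- C2 and C5: `|K| - 1 + ∑_{i<j, i,j∈K} σ_{ij}`. -/
noncomputable def formC2 {N : ℕ} (K : Finset (T N)) (σ : Var N → ℝ) : ℝ :=
  (K.card : ℝ) - 1 + ∑ e : Pair N with e.1.1 ∈ K ∧ e.1.2 ∈ K, σ (Var.pair e)

/-- C4 for `t = 1`: `|J| + ∑_{i∈J} σ_{1i} + ∑_{i<j, i,j∈J} σ_{ij}`. -/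
noncomputable def formC4First {N : ℕ} (J : Finset (T N)) (σ : Var N → ℝ) : ℝ :=
  (J.card : ℝ) + ∑ i ∈ J, σ (Var.first i)
    + ∑ e : Pair N with e.1.1 ∈ J ∧ e.1.2 ∈ J, σ (Var.pair e)

/-- C4 for `t = N-1`: `|J| + ∑_{i∈J} σ_{(N-1)i} + ∑_{i<j, i,j∈J} σ_{ij}`. -/
noncomputable def formC4Last {N : ℕ} (J : Finset (T N)) (σ : Var N → ℝ) : ℝ :=
  (J.card : ℝ) + ∑ i ∈ J, σ (Var.last i)
    + ∑ e : Pair N with e.1.1 ∈ J ∧ e.1.2 ∈ J, σ (Var.pair e)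

/-- C3 and C6: `1 + σ_{ij}`. -/
noncomputable def formC6 {N : ℕ} (v : Var N) (σ : Var N → ℝ) : ℝ := 1 + σ v

/-- The vector of real parts of `s`. -/
def rePart {N : ℕ} (s : Var N → ℂ) : Var N → ℝ := fun v => (s v).re

/-- `H(ℂ)`: the solution set of the conditions C1-C6. -/
def H (N : ℕ) : Set (Var N → ℂ) :=
  {s | (∀ J : Finset (T N), J.Nonempty → formC1 J (rePart s) < 0) ∧
    (∀ K : Finset (T N), 2 ≤ K.card → 0 < formC2 K (rePart s)) ∧
    (∀ J : Finset (T N), J.Nonempty → 0 < formC4First J (rePart s)) ∧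
    (∀ J : Finset (T N), J.Nonempty → 0 < formC4Last J (rePart s)) ∧
    (∀ v : Var N, 0 < formC6 v (rePart s))}

/-- The union of the hyperplanes of `ℝ^D` obtained from C1-C6 by replacing the inequality signs
by equality signs (a finite union, since every index set is finite). -/
def hyperplanes (N : ℕ) : Set (Var N → ℝ) :=
  (⋃ (J : Finset (T N)) (_ : J.Nonempty), {σ | formC1 J σ = 0}) ∪
  (⋃ (K : Finset (T N)) (_ : 2 ≤ K.card), {σ | formC2 K σ = 0}) ∪
  (⋃ (J : Finset (T N)) (_ : J.Nonempty), {σ | formC4First J σ = 0}) ∪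
  (⋃ (J : Finset (T N)) (_ : J.Nonempty), {σ | formC4Last J σ = 0}) ∪
  (⋃ v : Var N, {σ | formC6 v σ = 0})

/-! ## Rational functions of the variables `p^{-s_{ij}}` -/

/-- The value of the polynomial `P` at the point `(p^{-s_{ij}})`. -/
noncomputable def evalPow (p : ℕ) {N : ℕ} (P : MvPolynomial (Var N) ℚ) (s : Var N → ℂ) : ℂ :=
  MvPolynomial.aeval (fun v => (p : ℂ) ^ (-s v)) P

/-- `s₀` is a pole of `s ↦ P(p^{-s}) / Q(p^{-s})`: this function, which is holomorphic where the
denominator does not vanish, does not extend holomorphically to a neighbourhood of `s₀`. -/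
def IsPole (p : ℕ) {N : ℕ} (P Q : MvPolynomial (Var N) ℚ) (s₀ : Var N → ℂ) : Prop :=
  ¬ ∃ g : (Var N → ℂ) → ℂ, AnalyticAt ℂ g s₀ ∧
    ∀ᶠ s in 𝓝 s₀, evalPow p Q s ≠ 0 → g s = evalPow p P s / evalPow p Q s

end StringZeta

/-! The projective line over `ℚ_p` is the disjoint union of `p + 1` residue discs, each parametrized
by `ℤ_p`, and `0`, `1`, `∞` lie in three different discs. The distance of two points is the product
of their heights `max(1, |x|)` and of a chordal distance, which equals `1` if the discs differ. The
height differs from `1` only in the disc of `∞`, where it is the inverse of the chordal distance to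
`∞`. So `|F|` together with the density of the Haar measure is, up to a constant, a product of
powers of chordal distances along the edges of a graph on the `x_i` and `0`, `1`, `∞`. For each
choice of discs the integral splits into independent blocks, each with at most one marked point,
which sits at the centre of its disc (`lintegral_absIntegrand`).

Let `V` be the integral of one block `B` over `ℤ_p`. Reduction modulo `p` gives `V = q V + R`
(`mean_eq`): the term `q V` comes from the configurations in a single residue class, and `R`
involves only the integrals of proper subsets of `B`. Here `q = p^e`, where `e` is minus one of the
forms of C2 or C4, or the form of C1 (`ratio_exponent_cases`). The conditions therefore say that
every `q` is less than `1`. This yields convergence (`mean_ne_top`), and by induction it yields a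
rational expression for `V` whose denominators `1 - q` vanish only over the hyperplanes (`mean_mem`,
`lintegral_absIntegrand_mem`).

All of this concerns real exponents. To reach `s = σ + iτ`, consider the exponents `σ + zτ`: along
this line the integral is a moment generating function in `z`, hence holomorphic, and the identity
theorem carries the rational formula from real `z` to `z = i` (`zeta_mul_evalPow_eq`). Holomorphy in
all variables is then read off from the formula.

For non-negative exponents the integral diverges because `|F| ≥ 1` on a box of infinite volume
(`lintegral_absIntegrand_eq_top`). -/

open scoped ENNReal

set_option linter.unusedSectionVars false

namespace StringZeta

/-! ### Haar measure of `ℚ_p`: dilations, inversion, residue discs. -/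

section PadicHaar

variable (p : ℕ) [hp : Fact p.Prime]

instance : (padicHaar p).IsAddHaarMeasure := by
  unfold padicHaar; infer_instance

lemma natCast_ennreal_ne_zero : (p : ℝ≥0∞) ≠ 0 := by
  exact_mod_cast hp.1.ne_zero

lemma padicHaar_closedBall_one : padicHaar p (Metric.closedBall 0 1) = 1 :=
  Measure.addHaarMeasure_self (K₀ := padicUnitBall p)

/-- The Haar measure of `ℚ_p` restricted to `ℤ_p`. -/
noncomputable def unitHaar : Measure ℚ_[p] := (padicHaar p).restrict (Metric.closedBall 0 1)

instance : IsProbabilityMeasure (unitHaar p) :=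
  ⟨by rw [unitHaar, Measure.restrict_apply_univ, padicHaar_closedBall_one]⟩

variable {p}

lemma ae_unitHaar_norm_le_one : ∀ᵐ x ∂unitHaar p, ‖x‖ ≤ 1 := by
  have := ae_restrict_mem (μ := padicHaar p) (s := Metric.closedBall (0 : ℚ_[p]) 1)
    Metric.isClosed_closedBall.measurableSet
  filter_upwards [this] with x hx
  simpa using hx

lemma norm_p_mul_lt_one {x : ℚ_[p]} (hx : ‖x‖ ≤ 1) : ‖(p : ℚ_[p]) * x‖ < 1 := by
  rw [norm_mul]
  exact mul_lt_one_of_nonneg_of_lt_one_left (norm_nonneg _) Padic.norm_p_lt_one hx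

lemma norm_div_p_le_one {x : ℚ_[p]} (hx : ‖x‖ < 1) : ‖x / (p : ℚ_[p])‖ ≤ 1 := by
  have h := (Padic.norm_le_pow_iff_norm_lt_pow_add_one x (-1)).2 (by simpa using hx)
  have hp0 : (0 : ℝ) < p := by exact_mod_cast hp.1.pos
  rw [norm_div, Padic.norm_p, div_inv_eq_mul]
  rw [zpow_neg_one] at h
  calc ‖x‖ * p ≤ (p : ℝ)⁻¹ * p := by gcongr
    _ = 1 := by field_simp

lemma existsUnique_residue {x : ℚ_[p]} (hx : ‖x‖ ≤ 1) :
    ∃! a : Fin p, ‖x - ((a : ℕ) : ℚ_[p])‖ < 1 := by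
  obtain ⟨z, rfl⟩ : ∃ z : ℤ_[p], (z : ℚ_[p]) = x := ⟨⟨x, hx⟩, rfl⟩
  obtain ⟨n, ⟨hn, hn'⟩, huniq⟩ := PadicInt.existsUnique_mem_range z
  have key : ∀ m : ℕ, (z - (m : ℤ_[p]) ∈ IsLocalRing.maximalIdeal ℤ_[p] ↔
      ‖(z : ℚ_[p]) - (m : ℚ_[p])‖ < 1) := by
    intro m
    rw [IsLocalRing.mem_maximalIdeal, PadicInt.mem_nonunits, PadicInt.norm_def,
      PadicInt.coe_sub, PadicInt.coe_natCast]
  exact ⟨⟨n, hn⟩, (key n).1 hn', fun b hb => Fin.ext (huniq b ⟨b.2, (key b).2 hb⟩)⟩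

lemma norm_natCast_sub_natCast {a b : Fin p} (h : a ≠ b) :
    ‖((a : ℕ) : ℚ_[p]) - ((b : ℕ) : ℚ_[p])‖ = 1 := by
  have hle : ‖((a : ℕ) : ℚ_[p]) - ((b : ℕ) : ℚ_[p])‖ ≤ 1 := by
    simpa using Padic.norm_int_le_one (p := p) ((a : ℕ) - (b : ℕ) : ℤ)
  refine le_antisymm hle (not_lt.1 fun hlt => h ?_)
  have h1 : ‖((a : ℕ) : ℚ_[p])‖ ≤ 1 := by
    simpa using Padic.norm_int_le_one (p := p) ((a : ℕ) : ℤ)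
  exact (existsUnique_residue h1).unique (by simp) hlt

/-- `ℤ_p` is the disjoint union of its residue classes. -/
lemma closedBall_eq_iUnion_residue :
    Metric.closedBall (0 : ℚ_[p]) 1 =
      ⋃ a : Fin p, {x | ‖x - ((a : ℕ) : ℚ_[p])‖ < 1} := by
  ext x
  simp only [mem_closedBall_zero_iff, Set.mem_iUnion, Set.mem_ofPred_eq]
  refine ⟨fun hx => (existsUnique_residue hx).exists, fun ⟨a, ha⟩ => ?_⟩
  have h1 : ‖((a : ℕ) : ℚ_[p])‖ ≤ 1 := by
    simpa using Padic.norm_int_le_one (p := p) ((a : ℕ) : ℤ)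
  have := Padic.nonarchimedean (x - ((a : ℕ) : ℚ_[p])) ((a : ℕ) : ℚ_[p])
  rw [sub_add_cancel] at this
  exact this.trans (max_le ha.le h1)

lemma pairwise_disjoint_residue : Pairwise (Function.onFun Disjoint
    fun a : Fin p => {x : ℚ_[p] | ‖x - ((a : ℕ) : ℚ_[p])‖ < 1}) := by
  intro a b hab
  rw [Function.onFun, Set.disjoint_left]
  intro x hx hx'
  have hmem : x ∈ Metric.closedBall (0 : ℚ_[p]) 1 := by
    rw [closedBall_eq_iUnion_residue]; exact Set.mem_iUnion.2 ⟨a, hx⟩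
  exact hab ((existsUnique_residue (by simpa using hmem)).unique hx hx')

lemma measurableSet_residue (a : ℚ_[p]) : MeasurableSet {x : ℚ_[p] | ‖x - a‖ < 1} :=
  (isOpen_lt (by fun_prop) continuous_const).measurableSet

/-- Multiplication by `u` multiplies the Haar measure by a constant. -/
lemma map_mul_padicHaar (u : ℚ_[p]) (hu : u ≠ 0) :
    (padicHaar p).map (u * ·) =
      padicHaar p ((u * ·) ⁻¹' Metric.closedBall 0 1) • padicHaar p := by
  let e : ℚ_[p] ≃+ ℚ_[p] := AddEquiv.mk' (Equiv.mulLeft₀ u hu) (fun x y => mul_add u x y)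
  have he : Continuous e := continuous_const.mul continuous_id
  have hes : Continuous e.symm := continuous_const.mul continuous_id
  have : ((padicHaar p).map e).IsAddHaarMeasure := e.isAddHaarMeasure_map _ he hes
  have h := Measure.addHaarMeasure_unique ((padicHaar p).map e) (padicUnitBall p)
  rw [Measure.map_apply he.measurable (padicUnitBall p).isCompact.measurableSet] at h
  exact h

/-- The set is `pℤ_p`. Its `p` translates by residues partition `ℤ_p`, so each has measure `1/p`. -/
lemma padicHaar_preimage_p_inv :
    padicHaar p (((p : ℚ_[p])⁻¹ * ·) ⁻¹' Metric.closedBall 0 1) = (p : ℝ≥0∞)⁻¹ := by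
  set c := padicHaar p (((p : ℚ_[p])⁻¹ * ·) ⁻¹' Metric.closedBall 0 1) with hc
  have hp0 : (p : ℚ_[p]) ≠ 0 := by exact_mod_cast hp.1.ne_zero
  have h0 : ∀ a : Fin p, padicHaar p {x : ℚ_[p] | ‖x - ((a : ℕ) : ℚ_[p])‖ < 1} = c := by
    intro a
    rw [hc, ← measure_preimage_add_right (padicHaar p) ((a : ℕ) : ℚ_[p])]
    congr 1
    ext x
    simp only [Set.mem_ofPred_eq, Set.mem_preimage, mem_closedBall_zero_iff, add_sub_cancel_right,
      inv_mul_eq_div]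
    refine ⟨norm_div_p_le_one, fun h => ?_⟩
    have := norm_p_mul_lt_one h
    rwa [mul_div_cancel₀ _ hp0] at this
  have h1 := padicHaar_closedBall_one p
  rw [closedBall_eq_iUnion_residue, measure_iUnion pairwise_disjoint_residue
    fun a => measurableSet_residue _, tsum_fintype, Finset.sum_congr rfl fun a _ => h0 a] at h1
  simp only [Finset.sum_const, Finset.card_univ, Fintype.card_fin, nsmul_eq_mul] at h1
  exact ENNReal.eq_inv_of_mul_eq_one_left (by rw [mul_comm]; exact h1)

lemma padicHaar_closedBall_zpow (k : ℤ) :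
    padicHaar p (Metric.closedBall 0 ((p : ℝ) ^ k)) = (p : ℝ≥0∞) ^ k := by
  have hp0 : (p : ℚ_[p]) ≠ 0 := by exact_mod_cast hp.1.ne_zero
  have hpr : (0 : ℝ) < p := by exact_mod_cast hp.1.pos
  have step : ∀ k : ℤ, padicHaar p (Metric.closedBall 0 ((p : ℝ) ^ (k - 1))) =
      (p : ℝ≥0∞)⁻¹ * padicHaar p (Metric.closedBall 0 ((p : ℝ) ^ k)) := by
    intro k
    have h := congrArg (fun m => m (Metric.closedBall 0 ((p : ℝ) ^ k)))
      (map_mul_padicHaar (p := p) (p : ℚ_[p])⁻¹ (inv_ne_zero hp0))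
    simp only [padicHaar_preimage_p_inv, Measure.smul_apply, smul_eq_mul] at h
    rw [← h, Measure.map_apply (by fun_prop) Metric.isClosed_closedBall.measurableSet]
    congr 1
    ext x
    simp only [mem_closedBall_zero_iff, Set.mem_preimage, norm_mul, norm_inv, Padic.norm_p,
      inv_inv]
    rw [zpow_sub_one₀ hpr.ne', ← div_eq_mul_inv, le_div_iff₀ hpr, mul_comm]
  have hpe := natCast_ennreal_ne_zero p
  induction k with
  | zero => simpa using padicHaar_closedBall_one p
  | succ k ih =>
    have h := step (k + 1)
    rw [add_sub_cancel_right, ih] at h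
    rw [ENNReal.zpow_add hpe (by simp), h, zpow_one, mul_comm, ← mul_assoc,
      ENNReal.mul_inv_cancel hpe (by simp), one_mul]
  | pred k ih =>
    rw [step, ih, ENNReal.zpow_sub hpe (by simp), zpow_one, mul_comm]

lemma lintegral_mul_left_padicHaar {u : ℚ_[p]} (hu : u ≠ 0) {h : ℚ_[p] → ℝ≥0∞}
    (hh : Measurable h) :
    ∫⁻ x, h (u * x) ∂padicHaar p = ‖u‖ₑ⁻¹ * ∫⁻ x, h x ∂padicHaar p := by
  have hpr : (0 : ℝ) < p := by exact_mod_cast hp.1.pos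
  rw [← lintegral_map (g := (u * ·)) hh (by fun_prop), map_mul_padicHaar u hu,
    lintegral_smul_measure, smul_eq_mul]
  congr 1
  have : ((u * ·) ⁻¹' Metric.closedBall 0 1 : Set ℚ_[p]) =
      Metric.closedBall 0 ((p : ℝ) ^ u.valuation) := by
    ext x
    simp only [Set.mem_preimage, mem_closedBall_zero_iff, norm_mul,
      Padic.norm_eq_zpow_neg_valuation hu]
    rw [zpow_neg, inv_mul_le_iff₀ (by positivity), mul_one]
  rw [this, padicHaar_closedBall_zpow, ← ofReal_norm, Padic.norm_eq_zpow_neg_valuation hu,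
    zpow_neg, ENNReal.ofReal_inv_of_pos (by positivity), inv_inv,
    ← ENNReal.ofReal_natCast, ← ENNReal.rpow_intCast,
    ENNReal.ofReal_rpow_of_pos hpr, Real.rpow_intCast]

open Classical in
/-- Powers of the `p`-adic absolute value, with the value `0` at `0`. -/
noncomputable def normPow (t : ℝ) (x : ℚ_[p]) : ℝ≥0∞ := if x = 0 then 0 else ‖x‖ₑ ^ t

@[fun_prop]
lemma measurable_normPow (t : ℝ) : Measurable (normPow t : ℚ_[p] → ℝ≥0∞) := by
  classical
  exact Measurable.ite (measurableSet_singleton 0) measurable_const (measurable_enorm.pow_const t)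

@[simp] lemma normPow_zero_right (t : ℝ) : normPow t (0 : ℚ_[p]) = 0 := if_pos rfl

lemma normPow_of_ne {x : ℚ_[p]} (hx : x ≠ 0) (t : ℝ) : normPow t x = ‖x‖ₑ ^ t := if_neg hx

lemma normPow_eq_one {x : ℚ_[p]} (hx : ‖x‖ = 1) (t : ℝ) : normPow t x = 1 := by
  have : x ≠ 0 := by rintro rfl; simp at hx
  rw [normPow_of_ne this, ← ofReal_norm, hx]; simp

lemma normPow_mul (t : ℝ) (x y : ℚ_[p]) : normPow t (x * y) = normPow t x * normPow t y := by
  by_cases hx : x = 0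
  · simp [hx]
  by_cases hy : y = 0
  · simp [hy]
  rw [normPow_of_ne hx, normPow_of_ne hy, normPow_of_ne (mul_ne_zero hx hy), enorm_mul,
    ENNReal.mul_rpow_of_ne_top enorm_ne_top enorm_ne_top]

lemma normPow_p (t : ℝ) : normPow t (p : ℚ_[p]) = (p : ℝ≥0∞) ^ (-t) := by
  have hp0 : (p : ℚ_[p]) ≠ 0 := by exact_mod_cast hp.1.ne_zero
  have hpr : (0 : ℝ) < p := by exact_mod_cast hp.1.pos
  rw [normPow_of_ne hp0, ← ofReal_norm, Padic.norm_p, ENNReal.ofReal_inv_of_pos hpr,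
    ENNReal.ofReal_natCast, ENNReal.inv_rpow, ENNReal.rpow_neg]

lemma normPow_ne_top (t : ℝ) (x : ℚ_[p]) : normPow t x ≠ ⊤ := by
  by_cases hx : x = 0
  · simp [hx]
  · rw [normPow_of_ne hx]
    exact ENNReal.rpow_ne_top_of_ne_zero (by simpa using hx) enorm_ne_top

lemma normPow_add (s t : ℝ) (x : ℚ_[p]) : normPow (s + t) x = normPow s x * normPow t x := by
  by_cases hx : x = 0
  · simp [hx]
  · rw [normPow_of_ne hx, normPow_of_ne hx, normPow_of_ne hx,
      ENNReal.rpow_add _ _ (by simpa using hx) enorm_ne_top]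

lemma normPow_inv (t : ℝ) (x : ℚ_[p]) : normPow t x⁻¹ = normPow (-t) x := by
  by_cases hx : x = 0
  · simp [hx]
  · rw [normPow_of_ne hx, normPow_of_ne (inv_ne_zero hx), enorm_inv hx, ENNReal.inv_rpow,
      ENNReal.rpow_neg]

/-- The change of variables `x ↦ x⁻¹` for the Haar measure of `ℚ_p`. -/
lemma lintegral_inv_padicHaar {h : ℚ_[p] → ℝ≥0∞} (hh : Measurable h) (h0 : h 0 = 0) :
    ∫⁻ x, h x⁻¹ * normPow (-2) x ∂padicHaar p = ∫⁻ x, h x ∂padicHaar p := by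
  -- the multiplicative Haar measure
  set m : Measure ℚ_[p] := (padicHaar p).withDensity (normPow (-1)) with hm
  have hmint : ∀ f : ℚ_[p] → ℝ≥0∞, Measurable f →
      ∫⁻ x, f x ∂m = ∫⁻ x, normPow (-1) x * f x ∂padicHaar p := fun f hf => by
    rw [hm, lintegral_withDensity_eq_lintegral_mul _ (measurable_normPow _) hf]; rfl
  have hinv : ∀ f : ℚ_[p] → ℝ≥0∞, Measurable f → ∀ u : ℚ_[p], u ≠ 0 →
      ∫⁻ x, f (u * x) ∂m = ∫⁻ x, f x ∂m := by
    intro f hf u hu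
    have hcu : normPow (-1) u = ‖u‖ₑ⁻¹ := by rw [normPow_of_ne hu, ENNReal.rpow_neg_one]
    have hue : ‖u‖ₑ ≠ 0 := by simpa using hu
    rw [hmint _ (by fun_prop), hmint _ hf]
    have := lintegral_mul_left_padicHaar hu (h := fun x => normPow (-1) x * f x) (by fun_prop)
    simp only [normPow_mul, hcu, mul_assoc] at this
    rw [lintegral_const_mul _ (by fun_prop)] at this
    exact (ENNReal.mul_right_inj (ENNReal.inv_ne_zero.2 enorm_ne_top)
      (ENNReal.inv_ne_top.2 hue)).1 this
  -- A test function of positive finite integral, the indicator of `1 + pℤ_p`. Inserting it,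
  -- exchanging the integrals and cancelling it shows that the multiplicative Haar measure is
  -- invariant under inversion.
  set φ : ℚ_[p] → ℝ≥0∞ := {x | ‖x - 1‖ < 1}.indicator 1 with hφ
  have hφm : Measurable φ := measurable_one.indicator (measurableSet_residue 1)
  have hφint : ∫⁻ x, φ x ∂m = (padicHaar p) {x | ‖x - 1‖ < 1} := by
    rw [hmint _ hφm, ← lintegral_indicator_one (measurableSet_residue 1)]
    refine lintegral_congr fun x => ?_
    simp only [hφ, Set.indicator_apply, Set.mem_ofPred_eq, Pi.one_apply]
    split_ifs with hx
    · rw [mul_one, normPow_eq_one]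
      have := Padic.norm_eq_of_norm_add_lt_right (p := p) (z1 := x) (z2 := -1)
        (by simpa [← sub_eq_add_neg] using hx)
      simpa using this
    · simp
  have hφ0 : ∫⁻ x, φ x ∂m ≠ 0 := by
    rw [hφint]
    exact (IsOpen.measure_pos _ (isOpen_lt (by fun_prop) continuous_const) ⟨1, by simp⟩).ne'
  have hφt : ∫⁻ x, φ x ∂m ≠ ⊤ := by
    rw [hφint]
    have hsub : {x : ℚ_[p] | ‖x - 1‖ < 1} ⊆ Metric.closedBall 1 1 := fun x hx => by
      rw [mem_closedBall_iff_norm]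
      exact le_of_lt hx
    exact ((measure_mono hsub).trans_lt (isCompact_closedBall (1 : ℚ_[p]) 1).measure_lt_top).ne
  have hm0 : ∀ᵐ x ∂m, x ≠ 0 := by
    rw [hm, ae_withDensity_iff (measurable_normPow _)]
    refine Filter.Eventually.of_forall fun x hx hx0 => hx (by simp [hx0])
  have hinvm : Measurable (fun x : ℚ_[p] => x⁻¹) := measurable_inv
  have main : ∀ h : ℚ_[p] → ℝ≥0∞, Measurable h →
      (∫⁻ x, h x⁻¹ ∂m) * ∫⁻ x, φ x ∂m = (∫⁻ x, h x ∂m) * ∫⁻ x, φ x ∂m := by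
    intro h hh
    calc (∫⁻ x, h x⁻¹ ∂m) * ∫⁻ x, φ x ∂m
        = ∫⁻ x, ∫⁻ y, h x⁻¹ * φ y ∂m ∂m := by
          rw [← lintegral_mul_const _ (by fun_prop)]
          exact lintegral_congr fun x => (lintegral_const_mul _ hφm).symm
      _ = ∫⁻ x, ∫⁻ y, h x⁻¹ * φ (x * y) ∂m ∂m := by
          refine lintegral_congr_ae ?_
          filter_upwards [hm0] with x hx
          exact (hinv (fun y => h x⁻¹ * φ y) (by fun_prop) x hx).symm
      _ = ∫⁻ y, ∫⁻ x, h x⁻¹ * φ (x * y) ∂m ∂m :=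
          lintegral_lintegral_swap (Measurable.aemeasurable (by unfold Function.uncurry; fun_prop))
      _ = ∫⁻ y, ∫⁻ x, h (y * x⁻¹) * φ x ∂m ∂m := by
          refine lintegral_congr_ae ?_
          filter_upwards [hm0] with y hy
          rw [← hinv (fun x => h (y * x⁻¹) * φ x) (by fun_prop) y hy]
          refine lintegral_congr fun x => ?_
          rw [mul_comm x y, mul_inv, ← mul_assoc, mul_inv_cancel₀ hy, one_mul]
      _ = ∫⁻ x, ∫⁻ y, h (y * x⁻¹) * φ x ∂m ∂m :=
          lintegral_lintegral_swap (Measurable.aemeasurable (by unfold Function.uncurry; fun_prop))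
      _ = ∫⁻ x, ∫⁻ y, h y * φ x ∂m ∂m := by
          refine lintegral_congr_ae ?_
          filter_upwards [hm0] with x hx
          rw [← hinv (fun y => h y * φ x) (by fun_prop) x⁻¹ (inv_ne_zero hx)]
          exact lintegral_congr fun y => by rw [mul_comm y]
      _ = (∫⁻ x, h x ∂m) * ∫⁻ x, φ x ∂m := by
          rw [← lintegral_const_mul _ hφm]
          exact lintegral_congr fun x => lintegral_mul_const _ hh
  -- The factor `|x|` cancels the density `|x|⁻¹` of `m` on one side; on the other side, inverted,
  -- it turns this density into `|x|⁻²`.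
  have key := (ENNReal.mul_left_inj hφ0 hφt).1
    (main (fun x => h x * normPow 1 x) (by fun_prop))
  rw [hmint _ (by fun_prop), hmint _ (by fun_prop)] at key
  refine Eq.trans (lintegral_congr fun x => ?_) (key.trans (lintegral_congr fun x => ?_))
  · rw [normPow_inv, mul_left_comm, ← normPow_add]
    norm_num
  · rcases eq_or_ne x 0 with rfl | hx
    · simp [h0]
    · rw [mul_left_comm, ← normPow_add, normPow_of_ne hx]
      norm_num

/-- The dilation by `p` and a translation map `ℤ_p` onto a residue class. -/
lemma setLIntegral_residue {h : ℚ_[p] → ℝ≥0∞} (hh : Measurable h) (a : ℚ_[p]) :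
    ∫⁻ x in {x | ‖x - a‖ < 1}, h x ∂padicHaar p =
      (p : ℝ≥0∞)⁻¹ * ∫⁻ y, h (a + p * y) ∂unitHaar p := by
  have hp0 : (p : ℚ_[p]) ≠ 0 := by exact_mod_cast hp.1.ne_zero
  have hpe := natCast_ennreal_ne_zero p
  have hnp : ‖(p : ℚ_[p])‖ₑ⁻¹ = p := by
    rw [← ENNReal.rpow_neg_one, ← normPow_of_ne hp0, normPow_p, neg_neg, ENNReal.rpow_one]
  set k : ℚ_[p] → ℝ≥0∞ := {x : ℚ_[p] | ‖x - a‖ < 1}.indicator h with hk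
  have hkm : Measurable k := hh.indicator (measurableSet_residue a)
  have h1 := lintegral_mul_left_padicHaar hp0 (h := fun x => k (a + x)) (by fun_prop)
  rw [lintegral_add_left_eq_self k, hnp] at h1
  rw [← lintegral_indicator (measurableSet_residue a), unitHaar,
    ← lintegral_indicator Metric.isClosed_closedBall.measurableSet]
  rw [← hk, ← one_mul (∫⁻ x, k x ∂padicHaar p), ← ENNReal.inv_mul_cancel hpe (by simp),
    mul_assoc, ← h1]
  congr 1
  refine lintegral_congr fun y => ?_
  by_cases hy : ‖y‖ ≤ 1
  · rw [Set.indicator_of_mem (by simpa using hy), hk, Set.indicator_of_mem]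
    simpa using norm_p_mul_lt_one hy
  · rw [Set.indicator_of_notMem (by simpa using hy), hk, Set.indicator_of_notMem]
    rw [Set.mem_ofPred_eq, add_sub_cancel_left]
    exact fun h => hy (by simpa [hp0] using norm_div_p_le_one h)

/-- Self-similarity of the Haar measure of `ℤ_p`. -/
lemma lintegral_unitHaar {h : ℚ_[p] → ℝ≥0∞} (hh : Measurable h) :
    ∫⁻ x, h x ∂unitHaar p =
      ∑ a : Fin p, (p : ℝ≥0∞)⁻¹ * ∫⁻ y, h ((a : ℕ) + p * y) ∂unitHaar p := by
  conv_lhs => rw [unitHaar, closedBall_eq_iUnion_residue,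
    lintegral_iUnion (fun a => measurableSet_residue _) pairwise_disjoint_residue, tsum_fintype]
  exact Finset.sum_congr rfl fun a _ => setLIntegral_residue hh _

/-- The parametrization by `ℤ_p` of the residue disc of `ℙ¹(ℚ_p)` at a point of `ℙ¹(𝔽_p)`. -/
noncomputable def chart : Option (Fin p) → ℚ_[p] → ℚ_[p]
  | some a, y => (a : ℕ) + p * y
  | none, y => (p * y)⁻¹

/-- The density of the Haar measure in the chart `chart c`. -/
noncomputable def chartDensity : Option (Fin p) → ℚ_[p] → ℝ≥0∞
  | some _, _ => (p : ℝ≥0∞)⁻¹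
  | none, y => (p : ℝ≥0∞)⁻¹ * normPow (-2) ((p : ℚ_[p]) * y)

@[fun_prop]
lemma measurable_chart (c : Option (Fin p)) : Measurable (chart c) := by
  have hinvm : Measurable (fun x : ℚ_[p] => x⁻¹) := measurable_inv
  cases c <;> unfold chart <;> fun_prop

@[fun_prop]
lemma measurable_chartDensity (c : Option (Fin p)) : Measurable (chartDensity c) := by
  cases c <;> unfold chartDensity <;> fun_prop

/-- The Haar measure of `ℚ_p` in terms of the residue discs of the projective line. -/
lemma lintegral_padicHaar {h : ℚ_[p] → ℝ≥0∞} (hh : Measurable h) :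
    ∫⁻ x, h x ∂padicHaar p =
      ∑ c : Option (Fin p), ∫⁻ y, h (chart c y) * chartDensity c y ∂unitHaar p := by
  have hB : MeasurableSet (Metric.closedBall (0 : ℚ_[p]) 1) :=
    Metric.isClosed_closedBall.measurableSet
  have hinvm : Measurable (fun x : ℚ_[p] => x⁻¹) := measurable_inv
  rw [← lintegral_add_compl h hB, Fintype.sum_option, add_comm]
  congr 1
  -- Inversion carries the complement of `ℤ_p` onto the residue disc of `0` without its centre.
  · rw [← lintegral_indicator hB.compl, ← lintegral_inv_padicHaar (hh.indicator hB.compl)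
      (by simp)]
    have := setLIntegral_residue (h := fun x => h x⁻¹ * normPow (-2) x) (by fun_prop) 0
    simp only [zero_add] at this
    rw [← lintegral_const_mul _ (by fun_prop)] at this
    refine Eq.trans ?_ (this.trans (lintegral_congr fun y => ?_))
    · rw [← lintegral_indicator (measurableSet_residue 0)]
      refine lintegral_congr fun x => ?_
      rcases eq_or_ne x 0 with rfl | hx
      · simp
      by_cases hx1 : ‖x‖ < 1
      · rw [Set.indicator_of_mem, Set.indicator_of_mem (by simpa using hx1)]
        simpa using (one_lt_inv₀ (norm_pos_iff.2 hx)).2 hx1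
      · rw [Set.indicator_of_notMem, Set.indicator_of_notMem (by simpa using hx1), zero_mul]
        simpa [one_lt_inv₀ (norm_pos_iff.2 hx)] using hx1
    · simp only [chart, chartDensity]
      ring
  · change ∫⁻ x, h x ∂unitHaar p = _
    rw [lintegral_unitHaar hh]
    refine Finset.sum_congr rfl fun a _ => ?_
    rw [← lintegral_const_mul _ (by fun_prop)]
    exact lintegral_congr fun y => mul_comm _ _

end PadicHaar

/-! ### Product measures: decomposition of the factors and independence of blocks. -/

section ProductMeasure

variable {κ X C : Type*} [Fintype κ] [MeasurableSpace X]

/-- For a product of probability measures, functions of single coordinates are independent. -/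
lemma lintegral_pi_prod {ν : κ → Measure X} [∀ i, IsProbabilityMeasure (ν i)]
    {f : κ → X → ℝ≥0∞} (hf : ∀ i, Measurable (f i)) :
    ∫⁻ y, ∏ i, f i (y i) ∂Measure.pi ν = ∏ i, ∫⁻ y, f i y ∂ν i := by
  have hind := ProbabilityTheory.iIndepFun_pi (μ := ν) (X := f) fun i => (hf i).aemeasurable
  rw [ProbabilityTheory.lintegral_prod_eq_prod_lintegral_of_indepFun _ _ hind
    fun i => (hf i).comp (measurable_pi_apply i)]
  refine Finset.prod_congr rfl fun i _ => ?_
  exact (measurePreserving_eval ν i).lintegral_comp (hf i)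

/-- If each measure `m i` is a finite sum of push-forwards of measures with a density, then so is
the product measure. -/
lemma lintegral_pi_eq_sum [DecidableEq κ] [Fintype C] {m ν : κ → Measure X}
    [∀ i, SigmaFinite (m i)] [∀ i, IsProbabilityMeasure (ν i)]
    {φ : C → X → X} (hφ : ∀ c, Measurable (φ c))
    {d : κ → C → X → ℝ≥0∞} (hd : ∀ i c, Measurable (d i c))
    (H : ∀ i, ∀ h : X → ℝ≥0∞, Measurable h →
      ∫⁻ x, h x ∂m i = ∑ c, ∫⁻ y, h (φ c y) * d i c y ∂ν i)
    {h : (κ → X) → ℝ≥0∞} (hh : Measurable h) :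
    ∫⁻ x, h x ∂Measure.pi m =
      ∑ c : κ → C, ∫⁻ y, h (fun i => φ (c i) (y i)) * ∏ i, d i (c i) (y i) ∂Measure.pi ν := by
  have hΦ : ∀ c : κ → C, Measurable fun y : κ → X => fun i => φ (c i) (y i) := fun c =>
    measurable_pi_lambda _ fun i => (hφ _).comp (measurable_pi_apply i)
  have hD : ∀ c : κ → C, Measurable fun y : κ → X => ∏ i, d i (c i) (y i) := fun c =>
    Finset.measurable_fun_prod _ fun i _ => (hd _ _).comp (measurable_pi_apply i)
  set ρ : Measure (κ → X) := ∑ c : κ → C,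
    (((Measure.pi ν).withDensity fun y => ∏ i, d i (c i) (y i)).map
      fun y => fun i => φ (c i) (y i)) with hρ
  have hint : ∀ h : (κ → X) → ℝ≥0∞, Measurable h → ∫⁻ x, h x ∂ρ =
      ∑ c : κ → C, ∫⁻ y, h (fun i => φ (c i) (y i)) * ∏ i, d i (c i) (y i) ∂Measure.pi ν := by
    intro h hh
    rw [hρ, lintegral_finsetSum_measure]
    refine Finset.sum_congr rfl fun c _ => ?_
    rw [lintegral_map hh (hΦ c)]
    exact (lintegral_withDensity_eq_lintegral_mul _ (hD c) (hh.comp (hΦ c))).trans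
      (lintegral_congr fun y => mul_comm _ _)
  -- It suffices to compare boxes, where the product over `i` of the sums over `C` expands into the
  -- sum over all choices `c`.
  have hpi : Measure.pi m = ρ := by
    refine Measure.pi_eq fun s hs => ?_
    have hs' : ∀ i, Measurable ((s i).indicator (1 : X → ℝ≥0∞)) := fun i =>
      measurable_one.indicator (hs i)
    rw [← lintegral_indicator_one (MeasurableSet.univ_pi hs),
      hint _ (measurable_one.indicator (MeasurableSet.univ_pi hs))]
    have e1 : ∀ i, m i (s i) = ∑ c, ∫⁻ y, (s i).indicator 1 (φ c y) * d i c y ∂ν i := fun i => by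
      rw [← H i _ (hs' i), lintegral_indicator_one (hs i)]
    simp_rw [e1]
    rw [Finset.prod_univ_sum, Fintype.piFinset_univ]
    refine Finset.sum_congr rfl fun c _ => ?_
    rw [← lintegral_pi_prod (ν := ν)
      (f := fun i y => (s i).indicator 1 (φ (c i) y) * d i (c i) y)
      fun i => ((hs' i).comp (hφ _)).mul (hd _ _)]
    refine lintegral_congr fun y => ?_
    rw [Finset.prod_mul_distrib]
    congr 1
    classical
    simp only [Set.indicator_apply, Set.mem_univ_pi, Pi.one_apply]
    rw [Finset.prod_ite_zero]
    simp
  rw [hpi, hint h hh]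

/-- For a product of probability measures, functions of disjoint blocks of coordinates are
independent. -/
lemma lintegral_pi_prod_blocks [DecidableEq κ] [Inhabited X] {ν : κ → Measure X}
    [∀ i, IsProbabilityMeasure (ν i)] (s : Finset C) {B : C → Finset κ}
    (hB : ∀ c c', c ≠ c' → Disjoint (B c) (B c'))
    {f : C → (κ → X) → ℝ≥0∞} (hf : ∀ c, Measurable (f c)) (hdep : ∀ c, DependsOn (f c) (B c)) :
    ∫⁻ y, ∏ c ∈ s, f c y ∂Measure.pi ν = ∏ c ∈ s, ∫⁻ y, f c y ∂Measure.pi ν := by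
  classical
  have hind : ProbabilityTheory.iIndepFun (fun i (y : κ → X) => y i) (Measure.pi ν) :=
    ProbabilityTheory.iIndepFun_pi (μ := ν) (X := fun _ x => x) fun i => aemeasurable_id
  -- Extension by an arbitrary value outside `S`: it makes a function that depends only on `S`
  -- factor through the restriction to `S`.
  let ext : (S : Finset κ) → (S → X) → κ → X := fun S z i =>
    if h : i ∈ S then z ⟨i, h⟩ else default
  have hext : ∀ S, Measurable (ext S) := fun S => measurable_pi_lambda _ fun i => by
    by_cases h : i ∈ S
    · simp only [ext, h, dite_true]; fun_prop
    · simp only [ext, h, dite_false]; fun_prop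
  have hfac : ∀ (g : (κ → X) → ℝ≥0∞) (S : Finset κ), DependsOn g S →
      g = (fun z => g (ext S z)) ∘ fun y => fun i : S => y i := by
    intro g S hg
    funext y
    refine hg fun i hi => ?_
    have hi' : i ∈ S := hi
    simp [ext, hi']
  induction s using Finset.induction_on with
  | empty => simp
  | insert c s hc ih =>
    simp only [Finset.prod_insert hc]
    rw [← ih]
    have hdep' : DependsOn (fun y => ∏ c ∈ s, f c y) (s.biUnion B : Finset κ) := by
      intro x y hxy
      refine Finset.prod_congr rfl fun c hc => hdep c fun i hi => hxy i ?_
      exact Finset.mem_coe.2 (Finset.mem_biUnion.2 ⟨c, hc, hi⟩)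
    have hmeas : Measurable fun y => ∏ c ∈ s, f c y :=
      Finset.measurable_fun_prod _ fun c _ => hf c
    have hdisj : Disjoint (B c) (s.biUnion B) := by
      rw [Finset.disjoint_biUnion_right]
      exact fun c' hc' => hB _ _ fun h => hc (h ▸ hc')
    have := (hind.indepFun_finset (B c) (s.biUnion B) hdisj fun i => measurable_pi_apply i).comp
      ((hf c).comp (hext (B c))) (hmeas.comp (hext (s.biUnion B)))
    have h2 : ProbabilityTheory.IndepFun (f c) (fun y => ∏ c ∈ s, f c y) (Measure.pi ν) := by
      rw [hfac _ _ (hdep c), hfac _ _ hdep']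
      exact this
    exact ProbabilityTheory.lintegral_mul_eq_lintegral_mul_lintegral_of_indepFun (hf c) hmeas h2

end ProductMeasure

/-! ### Self-similar integrals attached to a marked graph. -/

/-- A graph without loops, some of whose vertices are marked. -/
structure MarkedGraph (ι E : Type*) where
  src : E → ι
  dst : E → ι
  ne : ∀ e, src e ≠ dst e
  marks : Finset ι

namespace MarkedGraph

variable {p : ℕ} [hp : Fact p.Prime] {ι E C : Type*} [DecidableEq ι] [Fintype E]
  (G : MarkedGraph ι E) (τ : E → ℝ)

/-- The edges between the vertices of `B`. -/
def edges (B : Finset ι) : Finset E := {e | G.src e ∈ B ∧ G.dst e ∈ B}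

lemma edges_eq_empty {B : Finset ι} (hB : B.card ≤ 1) : G.edges B = ∅ := by
  refine Finset.filter_eq_empty_iff.2 fun e _ h => ?_
  exact G.ne e (Finset.card_le_one.1 hB _ h.1 _ h.2)

/-- The product of the powers `|x_i - x_j|^{τ_e}` over the edges `e = {i, j}` in `B`. -/
noncomputable def prod (B : Finset ι) (x : ι → ℚ_[p]) : ℝ≥0∞ :=
  ∏ e ∈ G.edges B, normPow (τ e) (x (G.src e) - x (G.dst e))

lemma measurable_prod (B : Finset ι) : Measurable (G.prod τ B : (ι → ℚ_[p]) → ℝ≥0∞) :=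
  Finset.measurable_fun_prod _ fun _ _ => (measurable_normPow _).comp (by fun_prop)

lemma dependsOn_prod (B : Finset ι) :
    DependsOn (G.prod τ B : (ι → ℚ_[p]) → ℝ≥0∞) B := by
  intro x y hxy
  refine Finset.prod_congr rfl fun e he => ?_
  have he' := (Finset.mem_filter.1 he).2
  rw [hxy _ he'.1, hxy _ he'.2]

variable (p) in
/-- The factor by which `prod` changes under the dilation by `p`. -/
noncomputable def scale (B : Finset ι) : ℝ≥0∞ := (p : ℝ≥0∞) ^ (-∑ e ∈ G.edges B, τ e)

lemma prod_rpow_neg (s : Finset E) :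
    ∏ e ∈ s, (p : ℝ≥0∞) ^ (-τ e) = (p : ℝ≥0∞) ^ (-∑ e ∈ s, τ e) := by
  classical
  induction s using Finset.induction_on with
  | empty => simp
  | insert e s he ih =>
    rw [Finset.prod_insert he, Finset.sum_insert he, ih, neg_add,
      ENNReal.rpow_add _ _ (natCast_ennreal_ne_zero p) (by simp)]

lemma scale_mul_prod (B : Finset ι) (x : ι → ℚ_[p]) :
    G.scale p τ B * G.prod τ B x =
      ∏ e ∈ G.edges B, normPow (τ e) ((p : ℚ_[p]) * (x (G.src e) - x (G.dst e))) := by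
  simp_rw [normPow_mul, normPow_p]
  rw [Finset.prod_mul_distrib, prod_rpow_neg]
  rfl

/-- A product over the edges joining points of the same class splits into blocks. -/
lemma prod_edges_eq_prod_blocks [Fintype C] [DecidableEq C] (c : ι → C) (B : Finset ι)
    (y : ι → ℚ_[p]) :
    ∏ e ∈ G.edges B, (if c (G.src e) = c (G.dst e)
        then normPow (τ e) ((p : ℚ_[p]) * (y (G.src e) - y (G.dst e))) else 1) =
      ∏ a, (G.scale p τ {i ∈ B | c i = a} * G.prod τ {i ∈ B | c i = a} y) := by
  simp_rw [scale_mul_prod]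
  have h : ∀ a, G.edges {i ∈ B | c i = a} =
      {e ∈ G.edges B | c (G.src e) = a ∧ c (G.dst e) = a} := by
    intro a
    ext e
    simp only [edges, Finset.mem_filter, Finset.mem_univ, true_and]
    tauto
  simp_rw [h, Finset.prod_filter]
  rw [Finset.prod_comm]
  refine Finset.prod_congr rfl fun e _ => ?_
  split_ifs with he
  · rw [Finset.prod_eq_single (c (G.src e))]
    · simp [he]
    · intro a _ ha
      rw [if_neg]
      rintro ⟨h1, -⟩
      exact ha h1.symm
    · simp
  · rw [Finset.prod_eq_one]
    intro a _
    rw [if_neg]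
    rintro ⟨h1, h2⟩
    exact he (h1.trans h2.symm)

lemma norm_residue_add_sub {a b : Fin p} (hab : a ≠ b) {x y : ℚ_[p]} (hx : ‖x‖ ≤ 1)
    (hy : ‖y‖ ≤ 1) : ‖((a : ℕ) + p * x : ℚ_[p]) - ((b : ℕ) + p * y)‖ = 1 := by
  have h1 := norm_natCast_sub_natCast hab
  have h2 : ‖(p : ℚ_[p]) * x - p * y‖ < 1 := by
    have := Padic.nonarchimedean ((p : ℚ_[p]) * x) (-(p * y))
    rw [← sub_eq_add_neg, norm_neg] at this
    exact this.trans_lt (max_lt (norm_p_mul_lt_one hx) (norm_p_mul_lt_one hy))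
  have h3 : ((a : ℕ) + p * x : ℚ_[p]) - ((b : ℕ) + p * y) =
      (((a : ℕ) : ℚ_[p]) - ((b : ℕ) : ℚ_[p])) + (p * x - p * y) := by ring
  rw [h3, Padic.add_eq_max_of_ne (by rw [h1]; exact h2.ne'), h1, max_eq_left h2.le]

/-- Points in different classes are at distance `1` and do not interact; inside a class the residues
cancel and each difference acquires a factor `p`. -/
lemma prod_residue_add (B : Finset ι) (c : ι → Fin p) {y : ι → ℚ_[p]} (hy : ∀ i, ‖y i‖ ≤ 1) :
    G.prod τ B (fun i => ((c i : ℕ) : ℚ_[p]) + (p : ℚ_[p]) * y i) =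
      ∏ a, (G.scale p τ {i ∈ B | c i = a} * G.prod τ {i ∈ B | c i = a} y) := by
  rw [← prod_edges_eq_prod_blocks]
  refine Finset.prod_congr rfl fun e _ => ?_
  split_ifs with he
  · simp only [he]
    congr 1
    ring
  · exact normPow_eq_one (norm_residue_add_sub he (hy _) (hy _)) _

variable [Fintype ι]

variable (p) in
/-- The law of independent points of `ℤ_p`, the marked ones being fixed at `0`. -/
noncomputable def pointMeasure (i : ι) : Measure ℚ_[p] :=
  if i ∈ G.marks then Measure.dirac 0 else unitHaar p

instance (i : ι) : IsProbabilityMeasure (G.pointMeasure p i) := by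
  unfold pointMeasure; split_ifs <;> infer_instance

variable (p) in
/-- The joint law of the points. -/
noncomputable def measure : Measure (ι → ℚ_[p]) := Measure.pi (G.pointMeasure p)

instance : IsProbabilityMeasure (G.measure p) := by unfold measure; infer_instance

lemma ae_norm_le_one : ∀ᵐ y ∂G.measure p, ∀ i, ‖y i‖ ≤ 1 := by
  rw [ae_all_iff]
  intro i
  have h : ∀ᵐ x ∂G.pointMeasure p i, ‖x‖ ≤ 1 := by
    unfold pointMeasure
    split_ifs
    · rw [ae_dirac_iff ((isClosed_le continuous_norm continuous_const).measurableSet)]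
      simp
    · exact ae_unitHaar_norm_le_one
  exact (measurePreserving_eval (G.pointMeasure p) i).quasiMeasurePreserving.ae h

/-- The probability that the `i`-th point lies in the residue class `a`. -/
noncomputable def weight (i : ι) (a : Fin p) : ℝ≥0∞ :=
  if i ∈ G.marks then (if (a : ℕ) = 0 then 1 else 0) else (p : ℝ≥0∞)⁻¹

lemma weight_ne_top (i : ι) (a : Fin p) : G.weight i a ≠ ⊤ := by
  unfold weight
  split_ifs
  · simp
  · simp
  · exact ENNReal.inv_ne_top.2 (natCast_ennreal_ne_zero p)

lemma sum_weight (i : ι) : ∑ a : Fin p, G.weight i a = 1 := by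
  have : NeZero p := ⟨hp.1.ne_zero⟩
  unfold weight
  split_ifs
  · have h : ∀ a : Fin p, ((a : ℕ) = 0) = (a = 0) := fun a => by simp
    simp [h]
  · simp [ENNReal.mul_inv_cancel (natCast_ennreal_ne_zero p)]

/-- The joint law is self-similar: a free point has a uniform residue, and a marked point keeps the
residue `0` and stays at `0 = 0 + p·0`. -/
lemma lintegral_measure {h : (ι → ℚ_[p]) → ℝ≥0∞} (hh : Measurable h) :
    ∫⁻ x, h x ∂G.measure p = ∑ c : ι → Fin p,
      (∏ i, G.weight i (c i)) *
        ∫⁻ y, h (fun i => ((c i : ℕ) : ℚ_[p]) + (p : ℚ_[p]) * y i) ∂G.measure p := by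
  have : NeZero p := ⟨hp.1.ne_zero⟩
  unfold measure
  rw [lintegral_pi_eq_sum (ν := G.pointMeasure p) (φ := fun (a : Fin p) y => (a : ℕ) + p * y)
    (d := fun i a _ => G.weight i a) (fun _ => by fun_prop) (fun _ _ => measurable_const) ?_ hh]
  · refine Finset.sum_congr rfl fun c _ => ?_
    have hc : Measurable fun y : ι → ℚ_[p] => fun i => ((c i : ℕ) : ℚ_[p]) + (p : ℚ_[p]) * y i := by
      fun_prop
    rw [mul_comm]
    exact lintegral_mul_const _ (hh.comp hc)
  · intro i h hh
    unfold pointMeasure weight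
    split_ifs
    · simp only [lintegral_dirac, mul_zero, add_zero]
      rw [Finset.sum_eq_single 0]
      · simp
      · intro a _ ha
        rw [if_neg (by simpa using ha), mul_zero]
      · simp
    · rw [lintegral_unitHaar hh]
      refine Finset.sum_congr rfl fun c _ => ?_
      rw [lintegral_mul_const _ (by fun_prop), mul_comm]

variable (p) in
/-- The mean of `prod`. -/
noncomputable def mean (B : Finset ι) : ℝ≥0∞ := ∫⁻ x, G.prod τ B x ∂G.measure p

lemma scale_eq_one {B : Finset ι} (hB : B.card ≤ 1) : G.scale p τ B = 1 := by
  simp [scale, G.edges_eq_empty hB]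

lemma mean_eq_one {B : Finset ι} (hB : B.card ≤ 1) : G.mean p τ B = 1 := by
  simp [mean, prod, G.edges_eq_empty hB]

lemma lintegral_prod_blocks [Fintype C] [DecidableEq C] (B : Finset ι) (c : ι → C) :
    ∫⁻ y, ∏ a, (G.scale p τ {i ∈ B | c i = a} * G.prod τ {i ∈ B | c i = a} y) ∂G.measure p =
      ∏ a, (G.scale p τ {i ∈ B | c i = a} * G.mean p τ {i ∈ B | c i = a}) := by
  simp_rw [Finset.prod_mul_distrib]
  rw [lintegral_const_mul _ (Finset.measurable_fun_prod _ fun a _ => G.measurable_prod τ _)]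
  congr 1
  refine lintegral_pi_prod_blocks _ (B := fun a => {i ∈ B | c i = a}) ?_
    (fun a => G.measurable_prod τ _) (fun a => G.dependsOn_prod τ _)
  intro a b hab
  refine Finset.disjoint_filter.2 fun i _ ha hb => hab (ha.symm.trans hb)

/-- All points of `B` are in the same class. -/
def ConstOn (B : Finset ι) (c : ι → C) : Prop := ∃ a, ∀ i ∈ B, c i = a

lemma filter_ssubset_of_not_constOn [DecidableEq C] {B : Finset ι} {c : ι → C}
    (hc : ¬ ConstOn B c) (a : C) :
    ({i ∈ B | c i = a} : Finset ι) ⊂ B :=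
  (Finset.filter_subset _ _).ssubset_of_ne fun h =>
    hc ⟨a, fun i hi => (Finset.mem_filter.1 (h.symm ▸ hi : i ∈ ({i ∈ B | c i = a} : Finset ι))).2⟩

open Classical in
variable (p) in
/-- The contribution to `mean` of the points of `B` that are not all in the same class. -/
noncomputable def rest (B : Finset ι) : ℝ≥0∞ :=
  ∑ c : ι → Fin p with ¬ ConstOn B c, (∏ i, G.weight i (c i)) *
    ∏ a, (G.scale p τ {i ∈ B | c i = a} * G.mean p τ {i ∈ B | c i = a})

variable (p) in
/-- The factor by which the contribution to `mean` of the points of `B` changes if all of them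
move into the same residue class. -/
noncomputable def ratio (B : Finset ι) : ℝ≥0∞ :=
  (p : ℝ≥0∞) ^ (1 - (B.card : ℝ) - ∑ e ∈ G.edges B, τ e)

/-- The residues are independent, and those of the points outside `B` are unconstrained, with total
weight `1`. -/
lemma sum_weight_of_forall_eq (B : Finset ι) (a : Fin p) :
    ∑ c : ι → Fin p with ∀ i ∈ B, c i = a, ∏ i, G.weight i (c i) = ∏ i ∈ B, G.weight i a := by
  have h := Finset.prod_univ_sum (fun _ : ι => (Finset.univ : Finset (Fin p)))
    (fun i b => if i ∈ B → b = a then G.weight i b else 0)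
  rw [Fintype.piFinset_univ] at h
  rw [Finset.sum_filter]
  calc _ = ∑ c : ι → Fin p, ∏ i, (if i ∈ B → c i = a then G.weight i (c i) else 0) := by
        refine Finset.sum_congr rfl fun c _ => ?_
        rw [Finset.prod_ite_zero]
        simp
    _ = _ := by
        rw [← h, ← Finset.prod_subset (Finset.subset_univ B)]
        · refine Finset.prod_congr rfl fun i hi => ?_
          simp [hi]
        · intro i _ hi
          simp [hi, sum_weight]

-- If no point of `B` is marked, there are `p` common classes, each of weight `p^{-|B|}`. If one is
-- marked, the common class must be `0`, and the other `|B| - 1` points weigh `p⁻¹` each. The two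
-- counts agree, which is why blocks with and without a marked point share the same `ratio`.
open Classical in
lemma sum_weight_constOn {B : Finset ι} (hB : B.Nonempty) (hM : (B ∩ G.marks).card ≤ 1) :
    ∑ c : ι → Fin p with ConstOn B c, ∏ i, G.weight i (c i) =
      (p : ℝ≥0∞) ^ (1 - (B.card : ℝ)) := by
  have : NeZero p := ⟨hp.1.ne_zero⟩
  have hpe := natCast_ennreal_ne_zero p
  have h1 : ∑ c : ι → Fin p with ConstOn B c, ∏ i, G.weight i (c i) =
      ∑ a : Fin p, ∏ i ∈ B, G.weight i a := by
    simp_rw [← sum_weight_of_forall_eq, Finset.sum_filter]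
    rw [Finset.sum_comm]
    refine Finset.sum_congr rfl fun c _ => ?_
    split_ifs with hc
    · obtain ⟨a, ha⟩ := hc
      rw [Finset.sum_eq_single a, if_pos ha]
      · intro b _ hb
        rw [if_neg]
        intro h
        obtain ⟨i, hi⟩ := hB
        exact hb ((h i hi).symm.trans (ha i hi))
      · simp
    · rw [Finset.sum_eq_zero]
      intro a _
      rw [if_neg]
      exact fun h => hc ⟨a, h⟩
  rw [h1]
  have hpow : ∀ n : ℕ, ((p : ℝ≥0∞)⁻¹) ^ n = (p : ℝ≥0∞) ^ (-(n : ℝ)) := fun n => by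
    rw [ENNReal.rpow_neg, ENNReal.rpow_natCast, ENNReal.inv_pow]
  rcases (B ∩ G.marks).eq_empty_or_nonempty with h0 | ⟨j, hj⟩
  · have h2 : ∀ a : Fin p, ∏ i ∈ B, G.weight i a = (p : ℝ≥0∞)⁻¹ ^ B.card := fun a => by
      rw [← Finset.prod_const]
      refine Finset.prod_congr rfl fun i hi => ?_
      have : i ∉ G.marks := fun h => by
        have := Finset.mem_inter.2 ⟨hi, h⟩
        simp [h0] at this
      simp [weight, this]
    simp only [h2, Finset.sum_const, Finset.card_univ, Fintype.card_fin, nsmul_eq_mul]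
    rw [hpow, sub_eq_add_neg, ENNReal.rpow_add _ _ hpe (by simp), ENNReal.rpow_one]
  · have hjB := (Finset.mem_inter.1 hj).1
    have hjM := (Finset.mem_inter.1 hj).2
    have h2 : ∀ a : Fin p, ∏ i ∈ B, G.weight i a =
        (if a = 0 then 1 else 0) * (p : ℝ≥0∞)⁻¹ ^ (B.card - 1) := fun a => by
      rw [← Finset.mul_prod_erase B _ hjB, ← Finset.card_erase_of_mem hjB, ← Finset.prod_const]
      congr 1
      · simp [weight, hjM]
      · refine Finset.prod_congr rfl fun i hi => ?_
        have hi' := Finset.mem_erase.1 hi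
        have : i ∉ G.marks := fun h =>
          hi'.1 (Finset.card_le_one.1 hM _ (Finset.mem_inter.2 ⟨hi'.2, h⟩) _ hj)
        simp [weight, this]
    simp_rw [h2]
    rw [← Finset.sum_mul]
    have hc : 1 ≤ B.card := Finset.card_pos.2 hB
    rw [hpow]
    simp [Nat.cast_sub hc]

lemma prod_blocks_of_constOn {B : Finset ι} {c : ι → Fin p} (hc : ConstOn B c) (y : ι → ℚ_[p]) :
    ∏ a, (G.scale p τ {i ∈ B | c i = a} * G.prod τ {i ∈ B | c i = a} y) =
      G.scale p τ B * G.prod τ B y := by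
  obtain ⟨a, ha⟩ := hc
  rw [Finset.prod_eq_single a]
  · rw [Finset.filter_true_of_mem ha]
  · intro b _ hb
    rw [Finset.filter_false_of_mem fun i hi h => hb (h.symm.trans (ha i hi))]
    simp [scale, prod, G.edges_eq_empty (B := ∅) (by simp)]
  · simp

lemma scale_mul_rpow_card (B : Finset ι) :
    (p : ℝ≥0∞) ^ (1 - (B.card : ℝ)) * G.scale p τ B = G.ratio p τ B := by
  rw [scale, ratio, ← ENNReal.rpow_add _ _ (natCast_ennreal_ne_zero p) (by simp),
    sub_eq_add_neg _ (∑ e ∈ _, _)]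

open Classical in
/-- The self-similarity of the integral of `prod` over a set of configurations. -/
lemma exists_setLIntegral_prod_eq {B : Finset ι} (hB : B.Nonempty)
    (hM : (B ∩ G.marks).card ≤ 1) {S S' : Set (ι → ℚ_[p])} (hS : MeasurableSet S)
    (hS' : MeasurableSet S')
    (hSS' : ∀ c : ι → Fin p, ConstOn B c → ∀ y : ι → ℚ_[p],
      (fun i => ((c i : ℕ) : ℚ_[p]) + (p : ℚ_[p]) * y i) ∈ S ↔ y ∈ S') :
    ∃ R ≤ G.rest p τ B, (S = Set.univ → R = G.rest p τ B) ∧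
      ∫⁻ x in S, G.prod τ B x ∂G.measure p =
        G.ratio p τ B * ∫⁻ x in S', G.prod τ B x ∂G.measure p + R := by
  have hSm := (G.measurable_prod (p := p) τ B).indicator hS
  have hS'm := (G.measurable_prod (p := p) τ B).indicator hS'
  -- `R` is the part of the integral over `S` where the points of `B` occupy several classes.
  -- Forgetting the restriction to `S` bounds it by `rest`, and nothing is lost if `S` is
  -- everything.
  refine ⟨∑ c : ι → Fin p with ¬ ConstOn B c, (∏ i, G.weight i (c i)) *
    ∫⁻ y, S.indicator (G.prod τ B) (fun i => ((c i : ℕ) : ℚ_[p]) + (p : ℚ_[p]) * y i) ∂G.measure p,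
    Finset.sum_le_sum fun c _ => ?_, fun hu => Finset.sum_congr rfl fun c _ => ?_, ?_⟩
  · gcongr
    rw [← lintegral_prod_blocks]
    refine lintegral_mono_ae ?_
    filter_upwards [G.ae_norm_le_one] with y hy
    rw [← prod_residue_add _ _ _ _ hy]
    exact Set.indicator_le_self S (G.prod τ B) _
  · rw [← lintegral_prod_blocks, hu, Set.indicator_univ]
    congr 1
    refine lintegral_congr_ae ?_
    filter_upwards [G.ae_norm_le_one] with y hy
    rw [← prod_residue_add _ _ _ _ hy]
  · rw [← lintegral_indicator hS, lintegral_measure _ hSm,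
      ← Finset.sum_filter_add_sum_filter_not Finset.univ (ConstOn B)]
    congr 1
    rw [← scale_mul_rpow_card, ← G.sum_weight_constOn hB hM, mul_assoc, Finset.sum_mul]
    refine Finset.sum_congr rfl fun c hc => ?_
    have hc' := (Finset.mem_filter.1 hc).2
    rw [← lintegral_indicator hS', ← lintegral_const_mul _ hS'm]
    congr 1
    refine lintegral_congr_ae ?_
    filter_upwards [G.ae_norm_le_one] with y hy
    by_cases h : y ∈ S'
    · rw [Set.indicator_of_mem h, Set.indicator_of_mem ((hSS' c hc' y).2 h),
        prod_residue_add _ _ _ _ hy, prod_blocks_of_constOn _ _ hc']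
    · rw [Set.indicator_of_notMem h, Set.indicator_of_notMem (fun h' => h ((hSS' c hc' y).1 h')),
        mul_zero]

/-- Points in a common class reproduce the same integral after division by `p`; otherwise they split
into smaller blocks. The equation lives in `[0, ∞]` and determines the mean only once finiteness and
`ratio < 1` are known. -/
lemma mean_eq {B : Finset ι} (hB : B.Nonempty) (hM : (B ∩ G.marks).card ≤ 1) :
    G.mean p τ B = G.ratio p τ B * G.mean p τ B + G.rest p τ B := by
  obtain ⟨R, -, hR, h⟩ := G.exists_setLIntegral_prod_eq (p := p) τ hB hM MeasurableSet.univ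
    MeasurableSet.univ (fun _ _ _ => by simp)
  rw [hR rfl, setLIntegral_univ] at h
  exact h

/-! ### Convergence by truncation, and solution of the recursion. -/

/-- The configurations whose points in `B` are not all congruent modulo `p ^ k`. -/
def separated (B : Finset ι) (k : ℕ) : Set (ι → ℚ_[p]) :=
  ⋃ i ∈ B, ⋃ j ∈ B, {x | (p : ℝ)⁻¹ ^ k < ‖x i - x j‖}

lemma mem_separated {B : Finset ι} {k : ℕ} {x : ι → ℚ_[p]} :
    x ∈ separated B k ↔ ∃ i ∈ B, ∃ j ∈ B, (p : ℝ)⁻¹ ^ k < ‖x i - x j‖ := by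
  simp [separated]

lemma measurableSet_separated (B : Finset ι) (k : ℕ) :
    MeasurableSet (separated B k : Set (ι → ℚ_[p])) :=
  Finset.measurableSet_biUnion _ fun _ _ => Finset.measurableSet_biUnion _ fun _ _ =>
    (isOpen_lt continuous_const (by fun_prop)).measurableSet

lemma residueShift_mem_separated {B : Finset ι} {k : ℕ} {c : ι → Fin p} (hc : ConstOn B c)
    {y : ι → ℚ_[p]} :
    (fun i => ((c i : ℕ) : ℚ_[p]) + (p : ℚ_[p]) * y i) ∈ separated B (k + 1) ↔
      y ∈ separated B k := by
  obtain ⟨a, ha⟩ := hc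
  have hpr : (0 : ℝ) < (p : ℝ)⁻¹ := inv_pos.2 (by exact_mod_cast hp.1.pos)
  simp only [mem_separated]
  refine exists_congr fun i => and_congr_right fun hi => exists_congr fun j =>
    and_congr_right fun hj => ?_
  rw [ha i hi, ha j hj, add_sub_add_left_eq_sub, ← mul_sub, norm_mul, Padic.norm_p, pow_succ',
    mul_lt_mul_iff_right₀ hpr]

lemma lintegral_separated_zero (B : Finset ι) :
    ∫⁻ x in separated B 0, G.prod τ B x ∂G.measure p = 0 := by
  have : G.measure p (separated B 0) = 0 := by
    refine measure_eq_zero_iff_ae_notMem.2 ?_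
    filter_upwards [G.ae_norm_le_one] with y hy
    rw [mem_separated]
    push Not
    intro i _ j _
    have := Padic.nonarchimedean (y i) (-y j)
    rw [← sub_eq_add_neg, norm_neg] at this
    simpa using this.trans (max_le (hy i) (hy j))
  rw [Measure.restrict_zero_set this, lintegral_zero_measure]

lemma monotone_separated (B : Finset ι) :
    Monotone (separated B : ℕ → Set (ι → ℚ_[p])) := by
  intro k l hkl x
  simp only [mem_separated]
  rintro ⟨i, hi, j, hj, h⟩
  have hp1 : (1 : ℝ) ≤ p := by exact_mod_cast hp.1.one_lt.le
  exact ⟨i, hi, j, hj, (pow_le_pow_of_le_one (by positivity) (inv_le_one_of_one_le₀ hp1)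
    hkl).trans_lt h⟩

/-- The equation `V = qV + R` does not exclude `V = ∞`. The integrals `V_k` over the configurations
separated at level `k` start with `V_0 = 0` and satisfy `V_{k+1} ≤ q V_k + R`, so all are at most
`R/(1-q)`; monotone convergence gives `V`. -/
lemma mean_le {B : Finset ι} (hB : B.Nonempty) (hM : (B ∩ G.marks).card ≤ 1)
    (hE : (G.edges B).Nonempty) (hq : G.ratio p τ B < 1) :
    G.mean p τ B ≤ G.rest p τ B * (1 - G.ratio p τ B)⁻¹ := by
  set q := G.ratio p τ B with hqdef
  set R := G.rest p τ B
  have hq0 : 1 - q ≠ 0 := (tsub_pos_of_lt hq).ne'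
  have hbound : ∀ k, ∫⁻ x in separated B k, G.prod τ B x ∂G.measure p ≤ R * (1 - q)⁻¹ := by
    intro k
    induction k with
    | zero => rw [lintegral_separated_zero]; exact zero_le
    | succ k ih =>
      obtain ⟨R', hR', -, h⟩ := G.exists_setLIntegral_prod_eq (p := p) τ hB hM
        (measurableSet_separated B (k + 1)) (measurableSet_separated B k)
        (fun c hc y => residueShift_mem_separated hc)
      rw [h]
      calc q * _ + R' ≤ q * (R * (1 - q)⁻¹) + R * ((1 - q)⁻¹ * (1 - q)) := by
            rw [ENNReal.inv_mul_cancel hq0 (by simp), mul_one]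
            gcongr
        _ = R * (1 - q)⁻¹ * (q + (1 - q)) := by ring
        _ = R * (1 - q)⁻¹ := by rw [add_tsub_cancel_of_le hq.le, mul_one]
  -- An edge in `B` is needed here: where the product is non-zero, the ends of this edge are
  -- distinct, hence separated at some level.
  have hle : ∀ x : ι → ℚ_[p],
      G.prod τ B x ≤ ⨆ k, (separated B k).indicator (G.prod τ B) x := by
    intro x
    by_cases hx : G.prod τ B x = 0
    · rw [hx]; exact zero_le
    obtain ⟨e, he⟩ := hE
    have hne := (Finset.prod_ne_zero_iff.1 hx) e he
    have he' := (Finset.mem_filter.1 he).2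
    have hpos : 0 < ‖x (G.src e) - x (G.dst e)‖ := norm_pos_iff.2 fun h => hne (by simp [h])
    have hp1 : (1 : ℝ) < p := by exact_mod_cast hp.1.one_lt
    obtain ⟨k, hk⟩ := exists_pow_lt_of_lt_one hpos (inv_lt_one_of_one_lt₀ hp1)
    refine le_iSup_of_le k ?_
    rw [Set.indicator_of_mem]
    exact mem_separated.2 ⟨_, he'.1, _, he'.2, hk⟩
  calc G.mean p τ B ≤ ∫⁻ x, ⨆ k, (separated B k).indicator (G.prod τ B) x ∂G.measure p :=
        lintegral_mono hle
    _ = ⨆ k, ∫⁻ x, (separated B k).indicator (G.prod τ B) x ∂G.measure p :=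
        lintegral_iSup (fun k => (G.measurable_prod τ B).indicator (measurableSet_separated B k))
          fun k l hkl x => Set.indicator_le_indicator_of_subset (monotone_separated B hkl)
            (fun _ => zero_le) x
    _ ≤ R * (1 - q)⁻¹ := iSup_le fun k => by
        rw [lintegral_indicator (measurableSet_separated B k)]
        exact hbound k

lemma scale_ne_top (B : Finset ι) : G.scale p τ B ≠ ⊤ :=
  ENNReal.rpow_ne_top_of_ne_zero (natCast_ennreal_ne_zero p) (by simp)

/-- At most one vertex of `B` is marked, and every subset of at least two vertices spans an
edge. -/
def Admissible (B : Finset ι) : Prop :=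
  (B ∩ G.marks).card ≤ 1 ∧ ∀ K ⊆ B, 2 ≤ K.card → (G.edges K).Nonempty

lemma Admissible.mono {G : MarkedGraph ι E} {B K : Finset ι} (h : G.Admissible B) (hK : K ⊆ B) :
    G.Admissible K :=
  ⟨(Finset.card_le_card (Finset.inter_subset_inter_right hK)).trans h.1,
    fun L hL => h.2 L (hL.trans hK)⟩

open Classical in
/-- Convergence of the integral. -/
lemma mean_ne_top {B : Finset ι} (hB : G.Admissible B)
    (hq : ∀ K ⊆ B, 2 ≤ K.card → G.ratio p τ K < 1) : G.mean p τ B ≠ ⊤ := by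
  induction B using Finset.strongInduction with
  | H B ih =>
    rcases le_or_gt B.card 1 with h1 | h1
    · simp [mean_eq_one _ _ h1]
    have hne : B.Nonempty := Finset.card_pos.1 (by omega)
    refine ne_top_of_le_ne_top (ENNReal.mul_ne_top ?_ ?_)
      (G.mean_le τ hne hB.1 (hB.2 B subset_rfl h1) (hq B subset_rfl h1))
    · refine ENNReal.sum_ne_top.2 fun c hc => ENNReal.mul_ne_top
        (ENNReal.prod_ne_top fun i _ => G.weight_ne_top _ _)
        (ENNReal.prod_ne_top fun a _ => ENNReal.mul_ne_top (G.scale_ne_top _ _) ?_)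
      have hss := filter_ssubset_of_not_constOn (Finset.mem_filter.1 hc).2 a
      exact ih _ hss (hB.mono hss.1) fun K hK => hq K (hK.trans hss.1)
    · exact ENNReal.inv_ne_top.2 (tsub_pos_of_lt (hq B subset_rfl h1)).ne'

open Classical in
/-- The mean belongs to every ring of functions of the exponents that contains the elementary
functions in its recursive computation. -/
lemma mean_mem {Ω : Type*} (S : Subring (Ω → ℝ)) (τ : Ω → E → ℝ)
    (hp' : (fun _ => (p : ℝ)⁻¹) ∈ S) {B : Finset ι} (hB : G.Admissible B)
    (hscale : ∀ K ⊆ B, 2 ≤ K.card → (fun ω => (G.scale p (τ ω) K).toReal) ∈ S)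
    (hq : ∀ K ⊆ B, 2 ≤ K.card → ∀ ω, G.ratio p (τ ω) K < 1)
    (hqS : ∀ K ⊆ B, 2 ≤ K.card → (fun ω => (1 - (G.ratio p (τ ω) K).toReal)⁻¹) ∈ S) :
    (fun ω => (G.mean p (τ ω) B).toReal) ∈ S := by
  induction B using Finset.strongInduction with
  | H B ih =>
    rcases le_or_gt B.card 1 with h1 | h1
    · simp only [mean_eq_one _ _ h1, ENNReal.toReal_one]
      exact S.one_mem
    have hne : B.Nonempty := Finset.card_pos.1 (by omega)
    -- The equation of `mean_eq` solved for the mean, `V = R (1 - q)⁻¹`, after checking that all its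
    -- terms are finite.
    have hmean : (fun ω => (G.mean p (τ ω) B).toReal) =
        (∑ c : ι → Fin p with ¬ ConstOn B c, (∏ i, fun _ => (G.weight i (c i)).toReal) *
          ∏ a, ((fun ω => (G.scale p (τ ω) {i ∈ B | c i = a}).toReal) *
            fun ω => (G.mean p (τ ω) {i ∈ B | c i = a}).toReal)) *
          fun ω => (1 - (G.ratio p (τ ω) B).toReal)⁻¹ := by
      funext ω
      have hlt := hq B subset_rfl h1 ω
      have hR : G.rest p (τ ω) B ≠ ⊤ := by
        have := G.mean_eq (p := p) (τ ω) hne hB.1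
        refine fun h => G.mean_ne_top (p := p) (τ ω) hB (fun K hK hK' => hq K hK hK' ω) ?_
        rw [this, h, add_top]
      have hV := G.mean_ne_top (p := p) (τ ω) hB (fun K hK hK' => hq K hK hK' ω)
      have h2 := congrArg ENNReal.toReal (G.mean_eq (p := p) (τ ω) hne hB.1)
      rw [ENNReal.toReal_add (ENNReal.mul_ne_top hlt.ne_top hV) hR, ENNReal.toReal_mul] at h2
      have hlt' : (G.ratio p (τ ω) B).toReal < 1 := by
        simpa using (ENNReal.toReal_lt_toReal hlt.ne_top ENNReal.one_ne_top).2 hlt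
      have h3 : (G.rest p (τ ω) B).toReal =
          ∑ c : ι → Fin p with ¬ ConstOn B c, (∏ i, (G.weight i (c i)).toReal) *
          ∏ a, ((G.scale p (τ ω) {i ∈ B | c i = a}).toReal *
            (G.mean p (τ ω) {i ∈ B | c i = a}).toReal) := by
        rw [rest, ENNReal.toReal_sum]
        · simp only [ENNReal.toReal_mul, ENNReal.toReal_prod]
        · intro c hc
          exact ENNReal.sum_ne_top.1 hR c hc
      simp only [Pi.mul_apply, Finset.sum_apply, Finset.prod_apply]
      rw [← h3, eq_mul_inv_iff_mul_eq₀ (by linarith)]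
      linarith
    rw [hmean]
    refine S.mul_mem (S.sum_mem fun c hc => S.mul_mem (S.prod_mem fun i _ => ?_)
      (S.prod_mem fun a _ => ?_)) (hqS B subset_rfl h1)
    · unfold weight
      split_ifs
      · exact S.one_mem
      · exact S.zero_mem
      · simpa using hp'
    · have hss := filter_ssubset_of_not_constOn (Finset.mem_filter.1 hc).2 a
      refine S.mul_mem ?_ (ih _ hss (hB.mono hss.1) (fun K hK => hscale K (hK.trans hss.1))
        (fun K hK => hq K (hK.trans hss.1)) (fun K hK => hqS K (hK.trans hss.1)))
      rcases le_or_gt (({i ∈ B | c i = a} : Finset ι).card) 1 with h2 | h2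
      · simp only [scale_eq_one _ _ h2, ENNReal.toReal_one]
        exact S.one_mem
      · exact hscale _ hss.1 h2

end MarkedGraph

/-! ### Heights and chordal distances on the projective line. -/

section Chart

variable {p : ℕ} [hp : Fact p.Prime]

lemma normPow_congr {x y : ℚ_[p]} (h : ‖x‖ = ‖y‖) (t : ℝ) : normPow t x = normPow t y := by
  by_cases hx : x = 0
  · have hy : y = 0 := by rw [← norm_eq_zero, ← h, hx, norm_zero]
    rw [hx, hy]
  · have hy : y ≠ 0 := by rw [← norm_ne_zero_iff, ← h, norm_ne_zero_iff]; exact hx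
    rw [normPow_of_ne hx, normPow_of_ne hy, ← ofReal_norm, ← ofReal_norm, h]

lemma normPow_sub_comm (t : ℝ) (x y : ℚ_[p]) : normPow t (x - y) = normPow t (y - x) :=
  normPow_congr (norm_sub_rev x y) t

/-- The power `max(1, |x|)^t` at the point `x = chart c y`. -/
noncomputable def heightPow (t : ℝ) : Option (Fin p) → ℚ_[p] → ℝ≥0∞
  | some _, _ => 1
  | none, y => normPow (-t) ((p : ℚ_[p]) * y)

lemma heightPow_add (s t : ℝ) (c : Option (Fin p)) (y : ℚ_[p]) :
    heightPow (s + t) c y = heightPow s c y * heightPow t c y := by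
  cases c
  · simp only [heightPow, neg_add, normPow_add]
  · simp [heightPow]

/-- The point `y = 0` of the chart `none` is `∞`. There every power of the height, even the one with
exponent `0`, has the value `0`, by the convention in `normPow`. -/
lemma heightPow_zero {c : Option (Fin p)} {y : ℚ_[p]} (h : c = none → y ≠ 0) :
    heightPow 0 c y = 1 := by
  have hp0 : (p : ℚ_[p]) ≠ 0 := by exact_mod_cast hp.1.ne_zero
  cases c
  · simp only [heightPow, neg_zero]
    rw [normPow_of_ne (mul_ne_zero hp0 (h rfl)), ENNReal.rpow_zero]
  · rfl

lemma heightPow_sum {α : Type*} (s : Finset α) (t : α → ℝ) {c : Option (Fin p)} {y : ℚ_[p]}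
    (h : c = none → y ≠ 0) :
    heightPow (∑ a ∈ s, t a) c y = ∏ a ∈ s, heightPow (t a) c y := by
  classical
  induction s using Finset.induction_on with
  | empty => simp [heightPow_zero h]
  | insert a s ha ih => rw [Finset.sum_insert ha, Finset.prod_insert ha, heightPow_add, ih]

/-- The Haar measure is proportional to `max(1, |x|)²` times the uniform measure on the projective
line; this is the origin of the `2` in `exponent`. -/
lemma chartDensity_eq (c : Option (Fin p)) (y : ℚ_[p]) :
    chartDensity c y = (p : ℝ≥0∞)⁻¹ * heightPow 2 c y := by
  cases c <;> simp [chartDensity, heightPow]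

lemma norm_chart_some_le (a : Fin p) {y : ℚ_[p]} (hy : ‖y‖ ≤ 1) : ‖chart (some a) y‖ ≤ 1 := by
  have h1 : ‖((a : ℕ) : ℚ_[p])‖ ≤ 1 := by
    simpa using Padic.norm_int_le_one (p := p) ((a : ℕ) : ℤ)
  exact (Padic.nonarchimedean _ _).trans (max_le h1 (norm_p_mul_lt_one hy).le)

lemma normPow_chart_none_sub (t : ℝ) (a : Fin p) {x y : ℚ_[p]} (hx : ‖x‖ ≤ 1) (hx0 : x ≠ 0)
    (hy : ‖y‖ ≤ 1) :
    normPow t (chart none x - chart (some a) y) = normPow (-t) ((p : ℚ_[p]) * x) := by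
  have hp0 : (p : ℚ_[p]) ≠ 0 := by exact_mod_cast hp.1.ne_zero
  rw [← normPow_inv]
  refine normPow_congr ?_ t
  have h1 : 1 < ‖((p : ℚ_[p]) * x)⁻¹‖ := by
    rw [norm_inv]
    exact (one_lt_inv₀ (norm_pos_iff.2 (mul_ne_zero hp0 hx0))).2 (norm_p_mul_lt_one hx)
  have h2 := (norm_chart_some_le a hy).trans_lt h1
  rw [sub_eq_add_neg, Padic.add_eq_max_of_ne (by rw [norm_neg]; exact h2.ne'), norm_neg]
  exact max_eq_left h2.le

/-- The distance of two points of the projective line in terms of their heights and of their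
chordal distance. -/
lemma normPow_chart_sub (t : ℝ) {c d : Option (Fin p)} {x y : ℚ_[p]} (hx : ‖x‖ ≤ 1)
    (hy : ‖y‖ ≤ 1) (hx0 : c = none → x ≠ 0) (hy0 : d = none → y ≠ 0) :
    normPow t (chart c x - chart d y) = heightPow t c x * heightPow t d y *
      (if c = d then normPow t ((p : ℚ_[p]) * (x - y)) else 1) := by
  have hp0 : (p : ℚ_[p]) ≠ 0 := by exact_mod_cast hp.1.ne_zero
  cases c with
  | none =>
    cases d with
    | none =>
      simp only [chart, heightPow, if_true]
      rw [← normPow_inv, ← normPow_inv, ← normPow_mul, normPow_sub_comm t _ _, ← normPow_mul]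
      congr 1
      have := hx0 rfl
      have := hy0 rfl
      field_simp
    | some b =>
      rw [normPow_chart_none_sub t b hx (hx0 rfl) hy]
      simp [heightPow]
  | some a =>
    cases d with
    | none =>
      rw [normPow_sub_comm, normPow_chart_none_sub t a hy (hy0 rfl) hx]
      simp [heightPow]
    | some b =>
      simp only [chart, heightPow, one_mul, Option.some.injEq]
      split_ifs with hab
      · rw [hab]
        congr 1
        ring
      · exact normPow_eq_one (MarkedGraph.norm_residue_add_sub hab hx hy) _

end Chart

/-! ### The graph of the points `x_i` and `0`, `1`, `∞`. -/

section Graph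

/-- The complete graph on the points `x_i` and the three marked points `0`, `1`, `∞`, without
the edges between the marked points. -/
def pointGraph (N : ℕ) : MarkedGraph (T N ⊕ Fin 3) (T N ⊕ Var N) where
  src
    | Sum.inl _ => Sum.inr 2
    | Sum.inr (Sum.inl _) => Sum.inr 0
    | Sum.inr (Sum.inr (Sum.inl _)) => Sum.inr 1
    | Sum.inr (Sum.inr (Sum.inr e)) => Sum.inl e.1.1
  dst
    | Sum.inl i => Sum.inl i
    | Sum.inr (Sum.inl i) => Sum.inl i
    | Sum.inr (Sum.inr (Sum.inl i)) => Sum.inl i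
    | Sum.inr (Sum.inr (Sum.inr e)) => Sum.inl e.1.2
  ne
    | Sum.inl _ => by simp
    | Sum.inr (Sum.inl _) => by simp
    | Sum.inr (Sum.inr (Sum.inl _)) => by simp
    | Sum.inr (Sum.inr (Sum.inr e)) => by simpa using e.2.ne
  marks := Finset.univ.map Function.Embedding.inr

/-- The pairs that contain `i`. -/
def pairsAt {N : ℕ} (i : T N) : Finset (Pair N) := {e | e.1.1 = i ∨ e.1.2 = i}

/-- The exponents on the edges of `pointGraph`. -/
noncomputable def exponent {N : ℕ} (σ : Var N → ℝ) : T N ⊕ Var N → ℝ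
  | Sum.inl i => -(2 + (σ (Var.first i) + σ (Var.last i) + ∑ e ∈ pairsAt i, σ (Var.pair e)))
  | Sum.inr v => σ v

variable (p : ℕ) [hp : Fact p.Prime] {N : ℕ}

/-- The absolute value of the integrand, extended by `0` to the divisor. -/
noncomputable def absIntegrand (σ : Var N → ℝ) (x : T N → ℚ_[p]) : ℝ≥0∞ :=
  (∏ i : T N, normPow (σ (Var.first i)) (x i) * normPow (σ (Var.last i)) (1 - x i)) *
    ∏ e : Pair N, normPow (σ (Var.pair e)) (x e.1.1 - x e.1.2)

lemma measurable_absIntegrand (σ : Var N → ℝ) : Measurable (absIntegrand p σ) := by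
  unfold absIntegrand
  refine Measurable.mul (Finset.measurable_fun_prod _ fun i _ => Measurable.mul ?_ ?_)
    (Finset.measurable_fun_prod _ fun e _ => ?_) <;>
  exact (measurable_normPow _).comp (by fun_prop)

/-- The residue classes of the points, given those of the `x_i`. -/
def classOf (c : T N → Option (Fin p)) : T N ⊕ Fin 3 → Option (Fin p)
  | Sum.inl i => c i
  | Sum.inr 0 => some ⟨0, hp.1.pos⟩
  | Sum.inr 1 => some ⟨1, hp.1.one_lt⟩
  | Sum.inr 2 => none

lemma prod_pair_eq_prod_pairsAt {M : Type*} [CommMonoid M] (f : T N → Pair N → M) :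
    ∏ e : Pair N, f e.1.1 e * f e.1.2 e = ∏ i, ∏ e ∈ pairsAt i, f i e := by
  simp_rw [pairsAt, Finset.prod_filter]
  rw [Finset.prod_comm]
  refine Finset.prod_congr rfl fun e _ => ?_
  rw [← Finset.prod_subset (Finset.subset_univ {e.1.1, e.1.2}), Finset.prod_pair e.2.ne]
  · simp
  · intro i _ hi
    simp only [Finset.mem_insert, Finset.mem_singleton, not_or] at hi
    rw [if_neg]
    rintro (h | h)
    · exact hi.1 h.symm
    · exact hi.2 h.symm

/-- The integrand in the charts. -/
lemma absIntegrand_chart (σ : Var N → ℝ) (c : T N → Option (Fin p)) {y : T N ⊕ Fin 3 → ℚ_[p]}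
    (hy : ∀ i, ‖y i‖ ≤ 1) (hy0 : ∀ m, y (Sum.inr m) = 0) :
    absIntegrand p σ (fun i => chart (c i) (y (Sum.inl i))) *
        ∏ i, chartDensity (c i) (y (Sum.inl i)) =
      (p : ℝ≥0∞)⁻¹ ^ Fintype.card (T N) *
        ∏ a, ((pointGraph N).scale p (exponent σ) {i | classOf p c i = a} *
          (pointGraph N).prod (exponent σ) {i | classOf p c i = a} y) := by
  rw [← MarkedGraph.prod_edges_eq_prod_blocks]
  have huniv : (pointGraph N).edges Finset.univ = Finset.univ := by
    simp [MarkedGraph.edges]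
  rw [huniv]
  -- If some point is `∞` itself, both sides vanish: on the left through the density, on the right
  -- through the edge to `∞`.
  by_cases hdeg : ∃ i, c i = none ∧ y (Sum.inl i) = 0
  · obtain ⟨i, hi, hi0⟩ := hdeg
    rw [Finset.prod_eq_zero (f := fun i => chartDensity (c i) (y (Sum.inl i))) (Finset.mem_univ i)
      (by simp [hi, hi0, chartDensity]), mul_zero,
      Finset.prod_eq_zero (Finset.mem_univ (Sum.inl i)), mul_zero]
    simp [pointGraph, classOf, hi, hi0, hy0]
  have hd : ∀ i, c i = none → y (Sum.inl i) ≠ 0 := fun i hi hi0 => hdeg ⟨i, hi, hi0⟩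
  have h0 : ∀ i t, normPow t (chart (c i) (y (Sum.inl i))) = heightPow t (c i) (y (Sum.inl i)) *
      (if some ⟨0, hp.1.pos⟩ = c i then normPow t ((p : ℚ_[p]) * (0 - y (Sum.inl i))) else 1) := by
    intro i t
    have := normPow_chart_sub t (c := some ⟨0, hp.1.pos⟩) (x := 0) (by simp) (hy (Sum.inl i))
      (by simp) (hd i)
    rw [← normPow_congr (norm_neg _) t, ← zero_sub]
    simpa [chart, heightPow] using this
  have h1 : ∀ i t, normPow t (1 - chart (c i) (y (Sum.inl i))) =
      heightPow t (c i) (y (Sum.inl i)) *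
      (if some ⟨1, hp.1.one_lt⟩ = c i then normPow t ((p : ℚ_[p]) * (0 - y (Sum.inl i)))
        else 1) := by
    intro i t
    have := normPow_chart_sub t (c := some ⟨1, hp.1.one_lt⟩) (x := 0) (by simp) (hy (Sum.inl i))
      (by simp) (hd i)
    simpa [chart, heightPow] using this
  -- Heights are inverse chordal distances to the marked point `∞`, so they become edges to the
  -- vertex `Sum.inr 2`.
  have h2 : ∀ i t, heightPow t (c i) (y (Sum.inl i)) =
      if none = c i then normPow (-t) ((p : ℚ_[p]) * (0 - y (Sum.inl i))) else 1 := by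
    intro i t
    cases hc : c i with
    | none =>
      simp only [heightPow, if_true]
      exact normPow_congr (by simp) _
    | some a => simp [heightPow]
  have h3 : ∀ e : Pair N, normPow (σ (Var.pair e))
      (chart (c e.1.1) (y (Sum.inl e.1.1)) - chart (c e.1.2) (y (Sum.inl e.1.2))) =
      (heightPow (σ (Var.pair e)) (c e.1.1) (y (Sum.inl e.1.1)) *
        heightPow (σ (Var.pair e)) (c e.1.2) (y (Sum.inl e.1.2))) *
      (if c e.1.1 = c e.1.2 then normPow (σ (Var.pair e))
        ((p : ℚ_[p]) * (y (Sum.inl e.1.1) - y (Sum.inl e.1.2))) else 1) := fun e =>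
    normPow_chart_sub _ (hy _) (hy _) (hd _) (hd _)
  unfold absIntegrand
  simp_rw [h0, h1, h3, chartDensity_eq, Finset.prod_mul_distrib]
  rw [← Finset.prod_mul_distrib (f := fun e : Pair N => heightPow _ (c e.1.1) _),
    prod_pair_eq_prod_pairsAt fun i e => heightPow (σ (Var.pair e)) (c i) (y (Sum.inl i))]
  -- The total power of the height of `x_i`: `2` from the density, and one exponent from each factor
  -- of the integrand that contains `x_i`.
  have h4 : ∏ i, heightPow (2 + (σ (Var.first i) + σ (Var.last i) +
        ∑ e ∈ pairsAt i, σ (Var.pair e))) (c i) (y (Sum.inl i)) =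
      (∏ i, heightPow 2 (c i) (y (Sum.inl i))) *
      ((∏ i, heightPow (σ (Var.first i)) (c i) (y (Sum.inl i))) *
      (∏ i, heightPow (σ (Var.last i)) (c i) (y (Sum.inl i))) *
      ∏ i, ∏ e ∈ pairsAt i, heightPow (σ (Var.pair e)) (c i) (y (Sum.inl i))) := by
    simp_rw [← Finset.prod_mul_distrib]
    refine Finset.prod_congr rfl fun i _ => ?_
    rw [heightPow_add, heightPow_add, heightPow_add, heightPow_sum _ _ (hd i)]
  rw [Fintype.prod_sum_type, Fintype.prod_sum_type, Fintype.prod_sum_type]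
  simp only [pointGraph, classOf, exponent, hy0]
  simp_rw [← h2]
  rw [h4, Finset.prod_const, Finset.card_univ]
  ring_nf

lemma map_inl_measure : ((pointGraph N).measure p).map (fun y i => y (Sum.inl i)) =
    Measure.pi fun _ : T N => unitHaar p := by
  symm
  refine Measure.pi_eq fun s hs => ?_
  rw [Measure.map_apply (by fun_prop) (MeasurableSet.univ_pi hs)]
  have : (fun (y : T N ⊕ Fin 3 → ℚ_[p]) i => y (Sum.inl i)) ⁻¹' Set.univ.pi s =
      Set.univ.pi (Sum.elim s fun _ => Set.univ) := by
    ext y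
    simp [Set.mem_pi]
  rw [this, MarkedGraph.measure, Measure.pi_pi, Fintype.prod_sum_type]
  simp [MarkedGraph.pointMeasure, pointGraph]

lemma ae_mark_eq_zero : ∀ᵐ y ∂(pointGraph N).measure p, ∀ m, y (Sum.inr m) = 0 := by
  rw [ae_all_iff]
  intro m
  have h : ∀ᵐ x ∂(pointGraph N).pointMeasure p (Sum.inr m), x = 0 := by
    have hm : Sum.inr m ∈ (pointGraph N).marks := by simp [pointGraph]
    rw [MarkedGraph.pointMeasure, if_pos hm, ae_dirac_eq]
    simp
  exact (measurePreserving_eval ((pointGraph N).pointMeasure p)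
    (Sum.inr m)).quasiMeasurePreserving.ae h

lemma lintegral_absIntegrand_chart (σ : Var N → ℝ) (c : T N → Option (Fin p)) :
    ∫⁻ y, absIntegrand p σ (fun i => chart (c i) (y i)) * ∏ i, chartDensity (c i) (y i)
        ∂Measure.pi (fun _ : T N => unitHaar p) =
      (p : ℝ≥0∞)⁻¹ ^ Fintype.card (T N) *
        ∏ a, ((pointGraph N).scale p (exponent σ) {i | classOf p c i = a} *
          (pointGraph N).mean p (exponent σ) {i | classOf p c i = a}) := by
  have hm1 : Measurable fun y : T N → ℚ_[p] => fun i => chart (c i) (y i) :=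
    measurable_pi_lambda _ fun i => (measurable_chart _).comp (measurable_pi_apply i)
  have hm2 : Measurable fun y : T N → ℚ_[p] => ∏ i, chartDensity (c i) (y i) :=
    Finset.measurable_fun_prod _ fun i _ =>
      (measurable_chartDensity _).comp (measurable_pi_apply i)
  have hm3 : Measurable fun y : T N → ℚ_[p] => absIntegrand p σ (fun i => chart (c i) (y i)) *
      ∏ i, chartDensity (c i) (y i) := ((measurable_absIntegrand p σ).comp hm1).mul hm2
  have hm4 : Measurable fun y : T N ⊕ Fin 3 → ℚ_[p] => fun i => y (Sum.inl i) := by fun_prop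
  rw [← MarkedGraph.lintegral_prod_blocks, ← map_inl_measure, lintegral_map hm3 hm4,
    ← lintegral_const_mul _ (Finset.measurable_fun_prod _ fun a _ =>
      ((pointGraph N).measurable_prod _ _).const_mul _)]
  refine lintegral_congr_ae ?_
  filter_upwards [(pointGraph N).ae_norm_le_one, ae_mark_eq_zero p] with y hy hy0
  exact absIntegrand_chart p σ c hy hy0

/-- The integral of the absolute value as a finite sum over configurations of residue discs. -/
lemma lintegral_absIntegrand (σ : Var N → ℝ) :
    ∫⁻ x, absIntegrand p σ x ∂haar p N = ∑ c : T N → Option (Fin p),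
      (p : ℝ≥0∞)⁻¹ ^ Fintype.card (T N) *
        ∏ a, ((pointGraph N).scale p (exponent σ) {i | classOf p c i = a} *
          (pointGraph N).mean p (exponent σ) {i | classOf p c i = a}) := by
  simp_rw [← lintegral_absIntegrand_chart]
  exact lintegral_pi_eq_sum (ν := fun _ : T N => unitHaar p) (φ := chart)
    (d := fun _ => chartDensity) measurable_chart (fun _ => measurable_chartDensity)
    (fun _ h hh => lintegral_padicHaar hh) (measurable_absIntegrand p σ)

end Graph

/-! ### The linear forms C1-C6 as exponents of the recursion. -/

section Forms

variable {N : ℕ}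

/-- The pairs contained in `A`. -/
def pairsIn (A : Finset (T N)) : Finset (Pair N) := {e | e.1.1 ∈ A ∧ e.1.2 ∈ A}

/-- The pairs that meet `A`. -/
def pairsMeeting (A : Finset (T N)) : Finset (Pair N) := {e | e.1.1 ∈ A ∨ e.1.2 ∈ A}

/-- The variables in `formC1 A`. -/
def varsC1 (A : Finset (T N)) : Finset (Var N) := A.disjSum (A.disjSum (pairsMeeting A))

/-- The variables in `formC2 A`. -/
def varsC2 (A : Finset (T N)) : Finset (Var N) :=
  (∅ : Finset (T N)).disjSum ((∅ : Finset (T N)).disjSum (pairsIn A))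

/-- The variables in `formC4First A`. -/
def varsC4First (A : Finset (T N)) : Finset (Var N) :=
  A.disjSum ((∅ : Finset (T N)).disjSum (pairsIn A))

/-- The variables in `formC4Last A`. -/
def varsC4Last (A : Finset (T N)) : Finset (Var N) :=
  (∅ : Finset (T N)).disjSum (A.disjSum (pairsIn A))

lemma formC1_eq (A : Finset (T N)) (σ : Var N → ℝ) :
    formC1 A σ = ((A.card : ℤ) : ℝ) + ∑ v ∈ varsC1 A, σ v := by
  have : ∑ e ∈ pairsMeeting A, σ (Var.pair e) = ∑ e : Pair N with e.1.1 ∈ A, σ (Var.pair e)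
      + ∑ e : Pair N with e.1.1 ∉ A ∧ e.1.2 ∈ A, σ (Var.pair e) := by
    simp only [pairsMeeting, Finset.sum_filter]
    rw [← Finset.sum_add_distrib]
    refine Finset.sum_congr rfl fun e _ => ?_
    by_cases h1 : e.1.1 ∈ A <;> by_cases h2 : e.1.2 ∈ A <;> simp [h1, h2]
  simp only [formC1, varsC1, Finset.sum_disjSum, Finset.sum_add_distrib, this, Int.cast_natCast]
  ring

lemma formC2_eq (A : Finset (T N)) (σ : Var N → ℝ) :
    formC2 A σ = ((A.card - 1 : ℤ) : ℝ) + ∑ v ∈ varsC2 A, σ v := by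
  simp [formC2, varsC2, pairsIn]

lemma formC4First_eq (A : Finset (T N)) (σ : Var N → ℝ) :
    formC4First A σ = ((A.card : ℤ) : ℝ) + ∑ v ∈ varsC4First A, σ v := by
  simp [formC4First, varsC4First, pairsIn, add_assoc]

lemma formC4Last_eq (A : Finset (T N)) (σ : Var N → ℝ) :
    formC4Last A σ = ((A.card : ℤ) : ℝ) + ∑ v ∈ varsC4Last A, σ v := by
  simp [formC4Last, varsC4Last, pairsIn, add_assoc]

lemma sum_edges_pointGraph (K : Finset (T N ⊕ Fin 3)) (τ : T N ⊕ Var N → ℝ) :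
    ∑ e ∈ (pointGraph N).edges K, τ e =
      (if 2 ∈ K.toRight then ∑ i ∈ K.toLeft, τ (Sum.inl i) else 0) +
      ((if 0 ∈ K.toRight then ∑ i ∈ K.toLeft, τ (Sum.inr (Var.first i)) else 0) +
      ((if 1 ∈ K.toRight then ∑ i ∈ K.toLeft, τ (Sum.inr (Var.last i)) else 0) +
      ∑ e ∈ pairsIn K.toLeft, τ (Sum.inr (Var.pair e)))) := by
  have key : ∀ (m : Fin 3) (f : T N → ℝ), (∑ i, if Sum.inr m ∈ K ∧ Sum.inl i ∈ K then f i else 0) =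
      if m ∈ K.toRight then ∑ i ∈ K.toLeft, f i else 0 := by
    intro m f
    by_cases hm : Sum.inr m ∈ K
    · simp only [hm, true_and, Finset.mem_toRight, if_true]
      rw [← Finset.sum_filter]
      refine Finset.sum_congr ?_ fun _ _ => rfl
      ext i
      simp
    · simp [hm]
  rw [MarkedGraph.edges, Finset.sum_filter, Fintype.sum_sum_type, Fintype.sum_sum_type,
    Fintype.sum_sum_type]
  refine congrArg₂ (· + ·) (key 2 fun i => τ (Sum.inl i))
    (congrArg₂ (· + ·) (key 0 fun i => τ (Sum.inr (Var.first i)))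
    (congrArg₂ (· + ·) (key 1 fun i => τ (Sum.inr (Var.last i))) ?_))
  rw [pairsIn, Finset.sum_filter]
  simp only [Finset.mem_toLeft]
  rfl

/-- A pair with both ends in `A` is counted twice on the left, a pair with one end in `A` once. -/
lemma sum_pairsAt (A : Finset (T N)) (f : Pair N → ℝ) :
    ∑ i ∈ A, ∑ e ∈ pairsAt i, f e = ∑ e ∈ pairsMeeting A, f e + ∑ e ∈ pairsIn A, f e := by
  simp only [pairsMeeting, pairsIn, pairsAt, Finset.sum_filter]
  rw [Finset.sum_comm, ← Finset.sum_add_distrib]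
  refine Finset.sum_congr rfl fun e _ => ?_
  have hne := e.2.ne
  have : ∀ i, (if e.1.1 = i ∨ e.1.2 = i then f e else 0) =
      (if e.1.1 = i then f e else 0) + (if e.1.2 = i then f e else 0) := by
    intro i
    by_cases h1 : e.1.1 = i
    · have h2 : e.1.2 ≠ i := fun h => hne (h1.trans h.symm)
      simp [h1, h2]
    · simp [h1]
  simp_rw [this, Finset.sum_add_distrib, Finset.sum_ite_eq]
  by_cases h1 : e.1.1 ∈ A <;> by_cases h2 : e.1.2 ∈ A <;> simp [h1, h2]

/-- The edges to `∞` count the pairs inside `A` twice, with a minus sign. Adding these pairs once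
leaves every pair that meets `A` exactly once, as in C1; of the resulting `2|A|`, one `|A|` belongs
to the form. -/
lemma sum_exponent_inl (A : Finset (T N)) (σ : Var N → ℝ) :
    ∑ i ∈ A, exponent σ (Sum.inl i) + ∑ e ∈ pairsIn A, σ (Var.pair e) =
      -(A.card + formC1 A σ) := by
  simp only [exponent, formC1_eq, varsC1, Finset.sum_disjSum, Finset.sum_neg_distrib,
    Finset.sum_add_distrib, sum_pairsAt, Finset.sum_const, nsmul_eq_mul, Int.cast_natCast]
  ring

/-- The exponents of the recursion are the linear forms of the conditions. -/
lemma ratio_exponent_cases {K : Finset (T N ⊕ Fin 3)} (hK : K.toRight.card ≤ 1)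
    (hK2 : 2 ≤ K.card) :
    (2 ≤ K.toLeft.card ∧ ∀ σ : Var N → ℝ, 1 - (K.card : ℝ) -
        ∑ e ∈ (pointGraph N).edges K, exponent σ e = -formC2 K.toLeft σ) ∨
    (K.toLeft.Nonempty ∧ ∀ σ : Var N → ℝ, 1 - (K.card : ℝ) -
        ∑ e ∈ (pointGraph N).edges K, exponent σ e = -formC4First K.toLeft σ) ∨
    (K.toLeft.Nonempty ∧ ∀ σ : Var N → ℝ, 1 - (K.card : ℝ) -
        ∑ e ∈ (pointGraph N).edges K, exponent σ e = -formC4Last K.toLeft σ) ∨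
    (K.toLeft.Nonempty ∧ ∀ σ : Var N → ℝ, 1 - (K.card : ℝ) -
        ∑ e ∈ (pointGraph N).edges K, exponent σ e = formC1 K.toLeft σ) := by
  have hcard := Finset.card_toLeft_add_card_toRight (u := K)
  have hcard' : (K.card : ℝ) = K.toLeft.card + K.toRight.card := by exact_mod_cast hcard.symm
  simp_rw [sum_edges_pointGraph, hcard']
  rcases Nat.le_one_iff_eq_zero_or_eq_one.1 hK with h0 | h1
  · left
    have h0' := Finset.card_eq_zero.1 h0
    refine ⟨by omega, fun σ => ?_⟩
    simp only [h0', Finset.notMem_empty, if_false, Finset.card_empty, formC2, pairsIn, exponent]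
    push_cast
    ring
  · right
    have hne : K.toLeft.Nonempty := Finset.card_pos.1 (by omega)
    obtain ⟨m, hm⟩ := Finset.card_eq_one.1 h1
    -- The marked point is `0`, `1` or `∞`. The first two give C4 for `t = 1` and `t = N-1`; the
    -- last gives C1, with the opposite sign.
    fin_cases m
    · left
      refine ⟨hne, fun σ => ?_⟩
      simp [hm, formC4First, pairsIn, exponent]
      ring
    · right; left
      refine ⟨hne, fun σ => ?_⟩
      simp [hm, formC4Last, pairsIn, exponent]
      ring
    · right; right
      refine ⟨hne, fun σ => ?_⟩
      have hF := sum_exponent_inl K.toLeft σ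
      simp [hm]
      simp only [exponent] at hF ⊢
      linarith

end Forms

/-! ### The ring of rational functions with admissible denominators. -/

section Rational

variable (p : ℕ) [hp : Fact p.Prime] (N : ℕ)

/-- The real points of `H(ℂ)`. -/
def HReal : Set (Var N → ℝ) := {σ | (fun v => (σ v : ℂ)) ∈ H N}

variable {N}

lemma rePart_ofReal (σ : Var N → ℝ) : rePart (fun v => (σ v : ℂ)) = σ := rfl

lemma rePart_mem_HReal {s : Var N → ℂ} : rePart s ∈ HReal N ↔ s ∈ H N := Iff.rfl

/-- The value of a polynomial at the point `(p^{-σ})`, `σ` real. -/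
noncomputable def realEvalPow (P : MvPolynomial (Var N) ℚ) (σ : Var N → ℝ) : ℝ :=
  MvPolynomial.aeval (fun v => (p : ℝ) ^ (-σ v)) P

lemma evalPow_ofReal (P : MvPolynomial (Var N) ℚ) (σ : Var N → ℝ) :
    evalPow p P (fun v => (σ v : ℂ)) = (realEvalPow p P σ : ℂ) := by
  have : (fun v => (p : ℂ) ^ (-(σ v : ℂ))) = fun v => (((p : ℝ) ^ (-σ v) : ℝ) : ℂ) := by
    funext v
    rw [Complex.ofReal_cpow (by positivity)]
    simp
  rw [evalPow, realEvalPow, this]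
  exact (MvPolynomial.map_aeval (fun v => (p : ℝ) ^ (-σ v)) Complex.ofRealHom P).symm ▸ by
    simp [MvPolynomial.aeval_def]

variable (N) in
/-- The polynomials whose zeros lie over the hyperplanes. -/
noncomputable def denominators : Submonoid (MvPolynomial (Var N) ℚ) where
  carrier := {Q | ∀ s, evalPow p Q s = 0 → rePart s ∈ hyperplanes N}
  one_mem' := fun s h => by simp [evalPow] at h
  mul_mem' := fun {P Q} hP hQ s h => by
    rw [evalPow, map_mul, mul_eq_zero] at h
    exact h.elim (hP s) (hQ s)

variable (N) in
/-- The functions on the real points of `H(ℂ)` that are rational functions of the `p^{-σ}` with a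
denominator in `denominators`. -/
noncomputable def ratSubring : Subring (HReal N → ℝ) where
  carrier := {f | ∃ P : MvPolynomial (Var N) ℚ, ∃ Q ∈ denominators p N,
    ∀ σ : HReal N, f σ * realEvalPow p Q σ.1 = realEvalPow p P σ.1}
  zero_mem' := ⟨0, 1, one_mem _, fun σ => by simp [realEvalPow]⟩
  one_mem' := ⟨1, 1, one_mem _, fun σ => by simp [realEvalPow]⟩
  add_mem' := by
    rintro f g ⟨P, Q, hQ, h⟩ ⟨P', Q', hQ', h'⟩
    refine ⟨P * Q' + P' * Q, Q * Q', mul_mem hQ hQ', fun σ => ?_⟩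
    have h1 := h σ
    have h2 := h' σ
    simp only [realEvalPow, map_mul, map_add, Pi.add_apply] at *
    linear_combination (MvPolynomial.aeval (fun v => (p : ℝ) ^ (-σ.1 v)) Q') * h1 +
      (MvPolynomial.aeval (fun v => (p : ℝ) ^ (-σ.1 v)) Q) * h2
  neg_mem' := by
    rintro f ⟨P, Q, hQ, h⟩
    refine ⟨-P, Q, hQ, fun σ => ?_⟩
    have := h σ
    simp only [realEvalPow, map_neg, Pi.neg_apply] at *
    linear_combination - this
  mul_mem' := by
    rintro f g ⟨P, Q, hQ, h⟩ ⟨P', Q', hQ', h'⟩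
    refine ⟨P * P', Q * Q', mul_mem hQ hQ', fun σ => ?_⟩
    have h1 := h σ
    have h2 := h' σ
    simp only [realEvalPow, map_mul, Pi.mul_apply] at *
    rw [← h1, ← h2]
    ring

lemma const_mem_ratSubring (r : ℚ) : (fun _ => (r : ℝ)) ∈ ratSubring p N :=
  ⟨MvPolynomial.C r, 1, one_mem _, fun σ => by simp [realEvalPow]⟩

lemma realEvalPow_prod_X (S : Finset (Var N)) (σ : Var N → ℝ) :
    realEvalPow p (∏ v ∈ S, MvPolynomial.X v) σ = (p : ℝ) ^ (-∑ v ∈ S, σ v) := by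
  have hpr : (0 : ℝ) < p := by exact_mod_cast hp.1.pos
  rw [realEvalPow, map_prod, ← Finset.sum_neg_distrib, Real.rpow_sum_of_pos hpr]
  simp

lemma norm_evalPow_prod_X (S : Finset (Var N)) (s : Var N → ℂ) :
    ‖evalPow p (∏ v ∈ S, MvPolynomial.X v) s‖ = (p : ℝ) ^ (-∑ v ∈ S, rePart s v) := by
  have hpr : (0 : ℝ) < p := by exact_mod_cast hp.1.pos
  rw [evalPow, map_prod, norm_prod, ← Finset.sum_neg_distrib, Real.rpow_sum_of_pos hpr]
  refine Finset.prod_congr rfl fun v _ => ?_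
  rw [MvPolynomial.aeval_X, Complex.norm_natCast_cpow_of_pos hp.1.pos]
  rfl

/-- Monomials in the `p^{-s}` never vanish, so they are admissible denominators and positive powers
`p^σ` are available too. -/
lemma rpow_sum_mem_ratSubring (S : Finset (Var N)) :
    (fun σ : HReal N => (p : ℝ) ^ (∑ v ∈ S, σ.1 v)) ∈ ratSubring p N := by
  have hpr : (0 : ℝ) < p := by exact_mod_cast hp.1.pos
  refine ⟨1, ∏ v ∈ S, MvPolynomial.X v, fun s h => ?_, fun σ => ?_⟩
  · have := norm_evalPow_prod_X p S s
    rw [h, norm_zero] at this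
    exact absurd this (Real.rpow_pos_of_pos hpr _).ne
  · rw [realEvalPow_prod_X, ← Real.rpow_add hpr]
    simp [realEvalPow]

lemma rpow_neg_mem_ratSubring (v : Var N) :
    (fun σ : HReal N => (p : ℝ) ^ (-σ.1 v)) ∈ ratSubring p N :=
  ⟨MvPolynomial.X v, 1, one_mem _, fun σ => by simp [realEvalPow]⟩

lemma rpow_eq_one_iff_eq_zero {t : ℝ} : (p : ℝ) ^ t = 1 ↔ t = 0 := by
  have h1 : (1 : ℝ) < p := by exact_mod_cast hp.1.one_lt
  refine ⟨fun h => ?_, fun h => by simp [h]⟩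
  rcases lt_trichotomy t 0 with ht | ht | ht
  · exact absurd h (Real.rpow_lt_one_of_one_lt_of_neg h1 ht).ne
  · exact ht
  · exact absurd h (Real.one_lt_rpow h1 ht).ne'

/-- The denominator vanishes where `p^{-(k + ∑ s)} = 1`. Taking absolute values gives `k + ∑ Re s =
0`, which explains why the poles are located in terms of real parts alone. -/
lemma inv_one_sub_rpow_neg_mem {k : ℤ} {S : Finset (Var N)}
    (hS : ∀ σ : Var N → ℝ, k + ∑ v ∈ S, σ v = 0 → σ ∈ hyperplanes N)
    (hpos : ∀ σ ∈ HReal N, 0 < k + ∑ v ∈ S, σ v) :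
    (fun σ : HReal N => (1 - (p : ℝ) ^ (-(k + ∑ v ∈ S, σ.1 v)))⁻¹) ∈ ratSubring p N := by
  have hpr : (0 : ℝ) < p := by exact_mod_cast hp.1.pos
  have h1 : (1 : ℝ) < p := by exact_mod_cast hp.1.one_lt
  refine ⟨1, 1 - MvPolynomial.C ((p : ℚ) ^ (-k)) * ∏ v ∈ S, MvPolynomial.X v, fun s h => ?_,
    fun σ => ?_⟩
  · apply hS
    have h2 : ((p : ℂ) ^ (-k)) * evalPow p (∏ v ∈ S, MvPolynomial.X v) s = 1 := by
      rw [evalPow, map_sub, map_one, map_mul, MvPolynomial.aeval_C, sub_eq_zero] at h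
      rw [h, evalPow]
      simp
    have h3 := congrArg norm h2
    rw [norm_mul, norm_evalPow_prod_X, norm_one, norm_zpow, Complex.norm_natCast,
      ← Real.rpow_intCast, ← Real.rpow_add hpr, rpow_eq_one_iff_eq_zero] at h3
    push_cast at h3
    linarith
  · have h2 : realEvalPow p (1 - MvPolynomial.C ((p : ℚ) ^ (-k)) * ∏ v ∈ S, MvPolynomial.X v) σ.1 =
        1 - (p : ℝ) ^ (-(k + ∑ v ∈ S, σ.1 v)) := by
      have h3 := realEvalPow_prod_X p S σ.1
      rw [realEvalPow] at h3
      rw [realEvalPow, map_sub, map_one, map_mul, MvPolynomial.aeval_C, h3, neg_add,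
        Real.rpow_add hpr]
      simp [Real.rpow_neg hpr.le]
    rw [h2, inv_mul_cancel₀]
    · simp [realEvalPow]
    · have := Real.rpow_lt_one_of_one_lt_of_neg h1 (neg_neg_of_pos (hpos σ.1 σ.2))
      linarith

/-- The variant for the sign of C1. With `M = p^{-∑ σ}`, the inverse of `1 - p^{k + ∑ σ}` is `M / (M
- p^k)`, a quotient of polynomials in the `p^{-σ}`. -/
lemma inv_one_sub_rpow_mem {k : ℤ} {S : Finset (Var N)}
    (hS : ∀ σ : Var N → ℝ, k + ∑ v ∈ S, σ v = 0 → σ ∈ hyperplanes N)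
    (hneg : ∀ σ ∈ HReal N, k + ∑ v ∈ S, σ v < 0) :
    (fun σ : HReal N => (1 - (p : ℝ) ^ (k + ∑ v ∈ S, σ.1 v))⁻¹) ∈ ratSubring p N := by
  have hpr : (0 : ℝ) < p := by exact_mod_cast hp.1.pos
  have h1 : (1 : ℝ) < p := by exact_mod_cast hp.1.one_lt
  refine ⟨∏ v ∈ S, MvPolynomial.X v, ∏ v ∈ S, MvPolynomial.X v - MvPolynomial.C ((p : ℚ) ^ k),
    fun s h => ?_, fun σ => ?_⟩
  · apply hS
    have h2 : evalPow p (∏ v ∈ S, MvPolynomial.X v) s = (p : ℂ) ^ k := by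
      rw [evalPow, map_sub, MvPolynomial.aeval_C, sub_eq_zero] at h
      rw [evalPow, h]
      simp
    have h3 := congrArg norm h2
    rw [norm_evalPow_prod_X, norm_zpow, Complex.norm_natCast, ← Real.rpow_intCast,
      Real.rpow_right_inj hpr h1.ne'] at h3
    linarith
  · have h3 := realEvalPow_prod_X p S σ.1
    have h2 : realEvalPow p (∏ v ∈ S, MvPolynomial.X v - MvPolynomial.C ((p : ℚ) ^ k)) σ.1 =
        (1 - (p : ℝ) ^ (k + ∑ v ∈ S, σ.1 v)) * (p : ℝ) ^ (-∑ v ∈ S, σ.1 v) := by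
      rw [sub_mul, one_mul, ← Real.rpow_add hpr, add_neg_cancel_right, ← h3]
      simp [realEvalPow]
    rw [h2, h3, inv_mul_cancel_left₀]
    have := Real.rpow_lt_one_of_one_lt_of_neg h1 (hneg σ.1 σ.2)
    linarith

end Rational

/-! ### Convergence and rationality at real exponents. -/

section RealPoints

variable (p : ℕ) [hp : Fact p.Prime] {N : ℕ}

/-- Only two marked points can fail to be joined by an edge, and `B` contains at most one. -/
lemma admissible_pointGraph {B : Finset (T N ⊕ Fin 3)} (hB : B.toRight.card ≤ 1) :
    (pointGraph N).Admissible B := by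
  have hright : ∀ m m', Sum.inr m ∈ B → Sum.inr m' ∈ B → m = m' := fun m m' h h' =>
    Finset.card_le_one.1 hB m (Finset.mem_toRight.2 h) m' (Finset.mem_toRight.2 h')
  refine ⟨Finset.card_le_one.2 ?_, fun K hK hK2 => ?_⟩
  · rintro (i | m) hx (j | m') hy
    · simp [pointGraph] at hx
    · simp [pointGraph] at hx
    · simp [pointGraph] at hy
    · rw [hright m m' (Finset.mem_inter.1 hx).1 (Finset.mem_inter.1 hy).1]
  · obtain ⟨x, hx, y, hy, hxy⟩ := Finset.one_lt_card.1 hK2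
    have hmark : ∀ (i : T N) (m : Fin 3), Sum.inl i ∈ K → Sum.inr m ∈ K →
        ((pointGraph N).edges K).Nonempty := by
      intro i m hi hm
      fin_cases m
      · exact ⟨Sum.inr (Var.first i), Finset.mem_filter.2 ⟨Finset.mem_univ _, hm, hi⟩⟩
      · exact ⟨Sum.inr (Var.last i), Finset.mem_filter.2 ⟨Finset.mem_univ _, hm, hi⟩⟩
      · exact ⟨Sum.inl i, Finset.mem_filter.2 ⟨Finset.mem_univ _, hm, hi⟩⟩
    rcases x with i | m <;> rcases y with j | m'
    · rcases lt_or_gt_of_ne (fun h => hxy (congrArg Sum.inl h) : i ≠ j) with h | h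
      · exact ⟨Sum.inr (Var.pair ⟨(i, j), h⟩),
          Finset.mem_filter.2 ⟨Finset.mem_univ _, hx, hy⟩⟩
      · exact ⟨Sum.inr (Var.pair ⟨(j, i), h⟩),
          Finset.mem_filter.2 ⟨Finset.mem_univ _, hy, hx⟩⟩
    · exact hmark i m' hx hy
    · exact hmark j m hy hx
    · exact absurd (congrArg Sum.inr (hright m m' (hK hx) (hK hy))) hxy

/-- The points `0`, `1`, `∞` have distinct reductions modulo every prime `p`, including `2`. -/
lemma card_toRight_block (c : T N → Option (Fin p)) (a : Option (Fin p)) :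
    (Finset.toRight ({i | classOf p c i = a} : Finset (T N ⊕ Fin 3))).card ≤ 1 := by
  refine Finset.card_le_one.2 fun m hm m' hm' => ?_
  simp only [Finset.mem_toRight, Finset.mem_filter, Finset.mem_univ, true_and] at hm hm'
  have h := hm.trans hm'.symm
  clear hm hm'
  fin_cases m <;> fin_cases m' <;> first
    | rfl
    | simp only [classOf, Option.some.injEq, Fin.mk.injEq, reduceCtorEq, zero_ne_one,
        one_ne_zero] at h

lemma card_toRight_le_one_of_subset {K B : Finset (T N ⊕ Fin 3)} (h : K ⊆ B) (hB : B.toRight.card ≤ 1) :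
    K.toRight.card ≤ 1 :=
  (Finset.card_le_card (fun _ hm => Finset.mem_toRight.2 (h (Finset.mem_toRight.1 hm)))).trans hB

lemma ratio_lt_one {K : Finset (T N ⊕ Fin 3)} (hK : K.toRight.card ≤ 1) (hK2 : 2 ≤ K.card)
    {σ : Var N → ℝ} (hσ : σ ∈ HReal N) : (pointGraph N).ratio p (exponent σ) K < 1 := by
  refine ENNReal.rpow_lt_one_of_one_lt_of_neg (by exact_mod_cast hp.1.one_lt) ?_
  obtain ⟨h1, h2, h3, h4, -⟩ := hσ
  simp only [rePart_ofReal] at h1 h2 h3 h4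
  rcases ratio_exponent_cases hK hK2 with ⟨hA, h⟩ | ⟨hA, h⟩ | ⟨hA, h⟩ | ⟨hA, h⟩ <;> rw [h]
  · exact neg_neg_of_pos (h2 _ hA)
  · exact neg_neg_of_pos (h3 _ hA)
  · exact neg_neg_of_pos (h4 _ hA)
  · exact h1 _ hA

lemma toReal_natCast_rpow (t : ℝ) : ((p : ℝ≥0∞) ^ t).toReal = (p : ℝ) ^ t := by
  rw [← ENNReal.toReal_rpow, ENNReal.toReal_natCast]

lemma inv_one_sub_ratio_mem {K : Finset (T N ⊕ Fin 3)} (hK : K.toRight.card ≤ 1)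
    (hK2 : 2 ≤ K.card) :
    (fun σ : HReal N => (1 - ((pointGraph N).ratio p (exponent σ.1) K).toReal)⁻¹) ∈
      ratSubring p N := by
  simp only [MarkedGraph.ratio, toReal_natCast_rpow]
  rcases ratio_exponent_cases hK hK2 with ⟨hA, h⟩ | ⟨hA, h⟩ | ⟨hA, h⟩ | ⟨hA, h⟩ <;> simp_rw [h]
  · simp_rw [formC2_eq]
    refine inv_one_sub_rpow_neg_mem p (fun σ hσ => ?_) (fun σ hσ => ?_) <;>
      rw [← formC2_eq] at *
    · simp only [hyperplanes, Set.mem_union, Set.mem_iUnion, Set.mem_ofPred_eq]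
      exact Or.inl (Or.inl (Or.inl (Or.inr ⟨_, hA, hσ⟩)))
    · exact hσ.2.1 _ hA
  · simp_rw [formC4First_eq]
    refine inv_one_sub_rpow_neg_mem p (fun σ hσ => ?_) (fun σ hσ => ?_) <;>
      rw [← formC4First_eq] at *
    · simp only [hyperplanes, Set.mem_union, Set.mem_iUnion, Set.mem_ofPred_eq]
      exact Or.inl (Or.inl (Or.inr ⟨_, hA, hσ⟩))
    · exact hσ.2.2.1 _ hA
  · simp_rw [formC4Last_eq]
    refine inv_one_sub_rpow_neg_mem p (fun σ hσ => ?_) (fun σ hσ => ?_) <;>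
      rw [← formC4Last_eq] at *
    · simp only [hyperplanes, Set.mem_union, Set.mem_iUnion, Set.mem_ofPred_eq]
      exact Or.inl (Or.inr ⟨_, hA, hσ⟩)
    · exact hσ.2.2.2.1 _ hA
  · simp_rw [formC1_eq]
    refine inv_one_sub_rpow_mem p (fun σ hσ => ?_) (fun σ hσ => ?_) <;>
      rw [← formC1_eq] at *
    · simp only [hyperplanes, Set.mem_union, Set.mem_iUnion, Set.mem_ofPred_eq]
      exact Or.inl (Or.inl (Or.inl (Or.inl ⟨_, hA, hσ⟩)))
    · exact hσ.1 _ hA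

lemma scale_mem_ratSubring (K : Finset (T N ⊕ Fin 3)) :
    (fun σ : HReal N => ((pointGraph N).scale p (exponent σ.1) K).toReal) ∈ ratSubring p N := by
  have hpr : (0 : ℝ) < p := by exact_mod_cast hp.1.pos
  have h : (fun σ : HReal N => ((pointGraph N).scale p (exponent σ.1) K).toReal) =
      ∏ e ∈ (pointGraph N).edges K, fun σ : HReal N => (p : ℝ) ^ (-exponent σ.1 e) := by
    funext σ
    rw [Finset.prod_apply, MarkedGraph.scale, toReal_natCast_rpow, ← Finset.sum_neg_distrib,
      Real.rpow_sum_of_pos hpr]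
  rw [h]
  refine Subring.prod_mem _ fun e _ => ?_
  rcases e with i | v
  -- On an edge to `∞` the exponent carries a minus sign, so the factor is `p²` times an inverse
  -- monomial.
  · have h2 : (fun σ : HReal N => (p : ℝ) ^ (-exponent σ.1 (Sum.inl i))) =
        (fun _ => (((p : ℚ) ^ 2 : ℚ) : ℝ)) * fun σ : HReal N => (p : ℝ) ^ (∑ v ∈
          (({i} : Finset (T N)).disjSum (({i} : Finset (T N)).disjSum (pairsAt i)) :
            Finset (Var N)), σ.1 v) := by
      funext σ
      simp only [exponent, neg_neg, Pi.mul_apply, Finset.sum_disjSum, Finset.sum_singleton]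
      rw [Real.rpow_add hpr, ← add_assoc]
      norm_num
    rw [h2]
    exact Subring.mul_mem _ (const_mem_ratSubring p _) (rpow_sum_mem_ratSubring p _)
  · exact rpow_neg_mem_ratSubring p v

lemma inv_p_mem_ratSubring : (fun _ : HReal N => (p : ℝ)⁻¹) ∈ ratSubring p N := by
  have := const_mem_ratSubring (N := N) p ((p : ℚ)⁻¹)
  simpa using this

/-- Convergence at the real points of `H(ℂ)`. -/
lemma lintegral_absIntegrand_ne_top {σ : Var N → ℝ} (hσ : σ ∈ HReal N) :
    ∫⁻ x, absIntegrand p σ x ∂haar p N ≠ ⊤ := by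
  rw [lintegral_absIntegrand]
  refine ENNReal.sum_ne_top.2 fun c _ => ENNReal.mul_ne_top
    (ENNReal.pow_ne_top (ENNReal.inv_ne_top.2 (natCast_ennreal_ne_zero p)))
    (ENNReal.prod_ne_top fun a _ => ENNReal.mul_ne_top (MarkedGraph.scale_ne_top _ _ _) ?_)
  have hB := card_toRight_block p c a
  exact (pointGraph N).mean_ne_top _ (admissible_pointGraph hB)
    fun K hK hK2 => ratio_lt_one p (card_toRight_le_one_of_subset hK hB) hK2 hσ

/-- Rationality at the real points of `H(ℂ)`. -/
lemma lintegral_absIntegrand_mem :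
    (fun σ : HReal N => (∫⁻ x, absIntegrand p σ.1 x ∂haar p N).toReal) ∈ ratSubring p N := by
  have h : (fun σ : HReal N => (∫⁻ x, absIntegrand p σ.1 x ∂haar p N).toReal) =
      ∑ c : T N → Option (Fin p), (fun _ => (p : ℝ)⁻¹) ^ Fintype.card (T N) *
        ∏ a, ((fun σ : HReal N =>
            ((pointGraph N).scale p (exponent σ.1) {i | classOf p c i = a}).toReal) *
          fun σ : HReal N =>
            ((pointGraph N).mean p (exponent σ.1) {i | classOf p c i = a}).toReal) := by
    funext σ
    have hfin := lintegral_absIntegrand_ne_top p σ.2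
    rw [lintegral_absIntegrand] at hfin ⊢
    rw [ENNReal.toReal_sum (ENNReal.sum_ne_top.1 hfin)]
    simp [Finset.sum_apply, Finset.prod_apply, ENNReal.toReal_mul, ENNReal.toReal_prod]
  rw [h]
  refine Subring.sum_mem _ fun c _ => Subring.mul_mem _ (Subring.pow_mem _ (inv_p_mem_ratSubring p) _)
    (Subring.prod_mem _ fun a _ => Subring.mul_mem _ (scale_mem_ratSubring p _) ?_)
  have hB := card_toRight_block p c a
  exact (pointGraph N).mean_mem (ratSubring p N) (fun σ : HReal N => exponent σ.1) (inv_p_mem_ratSubring p)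
    (admissible_pointGraph hB) (fun K _ _ => scale_mem_ratSubring p K)
    (fun K hK hK2 σ => ratio_lt_one p (card_toRight_le_one_of_subset hK hB) hK2 σ.2)
    (fun K hK hK2 => inv_one_sub_ratio_mem p (card_toRight_le_one_of_subset hK hB) hK2)

end RealPoints

/-! ### The complex integrand and its absolute value. -/

section Integrand

variable (p : ℕ) [hp : Fact p.Prime] {N : ℕ}

/-- The linear factors of the divisor. -/
noncomputable def factor (v : Var N) (x : T N → ℚ_[p]) : ℚ_[p] :=
  match v with
  | Sum.inl i => x i
  | Sum.inr (Sum.inl i) => 1 - x i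
  | Sum.inr (Sum.inr e) => x e.1.1 - x e.1.2

lemma continuous_factor (v : Var N) : Continuous (factor p v) := by
  rcases v with i | i | e <;> unfold factor <;> fun_prop

lemma mem_divisor_iff {x : T N → ℚ_[p]} : x ∈ divisor p N ↔ ∃ v, factor p v x = 0 := by
  rw [divisor, Set.mem_ofPred_eq, mul_eq_zero, Finset.prod_eq_zero_iff, Finset.prod_eq_zero_iff]
  simp only [mul_eq_zero, Finset.mem_univ, true_and, Sum.exists, factor]
  rw [exists_or, or_assoc]

lemma measurableSet_divisor : MeasurableSet (divisor p N) := by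
  have : divisor p N = ⋃ v, {x | factor p v x = 0} := by
    ext x
    rw [mem_divisor_iff, Set.mem_iUnion]
    rfl
  rw [this]
  exact MeasurableSet.iUnion fun v =>
    (isClosed_eq (continuous_factor p v) continuous_const).measurableSet

lemma integrand_eq_prod (s : Var N → ℂ) (x : T N → ℚ_[p]) :
    integrand p N s x = ∏ v, ((‖factor p v x‖ : ℝ) : ℂ) ^ s v := by
  rw [Fintype.prod_sum_type, Fintype.prod_sum_type, ← mul_assoc, ← Finset.prod_mul_distrib]
  rfl

lemma absIntegrand_eq_prod (σ : Var N → ℝ) (x : T N → ℚ_[p]) :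
    absIntegrand p σ x = ∏ v, normPow (σ v) (factor p v x) := by
  rw [Fintype.prod_sum_type, Fintype.prod_sum_type, ← mul_assoc, ← Finset.prod_mul_distrib]
  rfl

lemma measurable_integrand (s : Var N → ℂ) : Measurable (integrand p N s) := by
  have : integrand p N s = fun x => ∏ v, ((‖factor p v x‖ : ℝ) : ℂ) ^ s v :=
    funext fun x => integrand_eq_prod p s x
  rw [this]
  exact Finset.measurable_fun_prod _ fun v _ => Measurable.pow_const
    (Complex.measurable_ofReal.comp (measurable_norm.comp (continuous_factor p v).measurable)) _

lemma absIntegrand_of_mem {σ : Var N → ℝ} {x : T N → ℚ_[p]} (hx : x ∈ divisor p N) :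
    absIntegrand p σ x = 0 := by
  obtain ⟨v, hv⟩ := (mem_divisor_iff p).1 hx
  rw [absIntegrand_eq_prod]
  exact Finset.prod_eq_zero (Finset.mem_univ v) (by simp [hv])

lemma absIntegrand_ne_top (σ : Var N → ℝ) (x : T N → ℚ_[p]) : absIntegrand p σ x ≠ ⊤ := by
  rw [absIntegrand_eq_prod]
  exact ENNReal.prod_ne_top fun v _ => normPow_ne_top _ _

lemma toReal_normPow {t : ℝ} {x : ℚ_[p]} (hx : x ≠ 0) : (normPow t x).toReal = ‖x‖ ^ t := by
  rw [normPow_of_ne hx, ← ENNReal.toReal_rpow, toReal_enorm]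

lemma enorm_integrand {s : Var N → ℂ} {x : T N → ℚ_[p]} (hx : x ∉ divisor p N) :
    ‖integrand p N s x‖ₑ = absIntegrand p (rePart s) x := by
  rw [mem_divisor_iff] at hx
  push Not at hx
  rw [← ENNReal.toReal_eq_toReal_iff' enorm_ne_top (absIntegrand_ne_top p _ _), toReal_enorm,
    integrand_eq_prod, absIntegrand_eq_prod, norm_prod, ENNReal.toReal_prod]
  refine Finset.prod_congr rfl fun v _ => ?_
  rw [toReal_normPow p (hx v), Complex.norm_cpow_eq_rpow_re_of_pos (norm_pos_iff.2 (hx v))]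
  rfl

lemma setLIntegral_absIntegrand (σ : Var N → ℝ) :
    ∫⁻ x in (divisor p N)ᶜ, absIntegrand p σ x ∂haar p N =
      ∫⁻ x, absIntegrand p σ x ∂haar p N := by
  rw [← lintegral_indicator (measurableSet_divisor p).compl]
  refine lintegral_congr fun x => ?_
  by_cases hx : x ∈ divisor p N
  · rw [Set.indicator_of_notMem (by simpa using hx), absIntegrand_of_mem p hx]
  · rw [Set.indicator_of_mem (by simpa using hx)]

lemma lintegral_enorm_integrand (s : Var N → ℂ) :
    ∫⁻ x in (divisor p N)ᶜ, ‖integrand p N s x‖ₑ ∂haar p N =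
      ∫⁻ x, absIntegrand p (rePart s) x ∂haar p N := by
  rw [← setLIntegral_absIntegrand]
  exact setLIntegral_congr_fun (measurableSet_divisor p).compl fun x hx => enorm_integrand p hx

lemma integrableOn_integrand {s : Var N → ℂ} (hs : s ∈ H N) :
    IntegrableOn (integrand p N s) (divisor p N)ᶜ (haar p N) := by
  refine ⟨(measurable_integrand p s).aestronglyMeasurable, ?_⟩
  rw [HasFiniteIntegral, lintegral_enorm_integrand]
  exact (lintegral_absIntegrand_ne_top p (rePart_mem_HReal.2 hs)).lt_top

end Integrand

/-! ### The region `H(ℂ)`. -/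

section Region

variable {N : ℕ}

lemma isLinearMap_sum_rePart (S : Finset (Var N)) :
    IsLinearMap ℝ fun s : Var N → ℂ => ∑ v ∈ S, rePart s v where
  map_add s t := by simp [rePart, Finset.sum_add_distrib]
  map_smul a s := by simp [rePart, Finset.mul_sum]

lemma continuous_sum_rePart (S : Finset (Var N)) :
    Continuous fun s : Var N → ℂ => ∑ v ∈ S, rePart s v := by
  unfold rePart; fun_prop

lemma isOpen_convex_pos (k : ℤ) (S : Finset (Var N)) :
    IsOpen {s : Var N → ℂ | 0 < k + ∑ v ∈ S, rePart s v} ∧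
      Convex ℝ {s : Var N → ℂ | 0 < k + ∑ v ∈ S, rePart s v} := by
  have h : {s : Var N → ℂ | 0 < k + ∑ v ∈ S, rePart s v} =
      {s | -(k : ℝ) < ∑ v ∈ S, rePart s v} := by
    ext s
    simp only [Set.mem_ofPred_eq]
    exact neg_lt_iff_pos_add'.symm
  rw [h]
  exact ⟨isOpen_lt continuous_const (continuous_sum_rePart S),
    convex_halfSpace_gt (isLinearMap_sum_rePart S) _⟩

lemma isOpen_convex_neg (k : ℤ) (S : Finset (Var N)) :
    IsOpen {s : Var N → ℂ | k + ∑ v ∈ S, rePart s v < 0} ∧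
      Convex ℝ {s : Var N → ℂ | k + ∑ v ∈ S, rePart s v < 0} := by
  have h : {s : Var N → ℂ | k + ∑ v ∈ S, rePart s v < 0} =
      {s | ∑ v ∈ S, rePart s v < -(k : ℝ)} := by
    ext s
    simp only [Set.mem_ofPred_eq]
    exact ⟨fun h => by linarith, fun h => by linarith⟩
  rw [h]
  exact ⟨isOpen_lt (continuous_sum_rePart S) continuous_const,
    convex_halfSpace_lt (isLinearMap_sum_rePart S) _⟩

lemma isOpen_convex_iInter {α : Type*} [Finite α] {P : α → Prop} {f : α → Set (Var N → ℂ)}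
    (h : ∀ a, IsOpen (f a) ∧ Convex ℝ (f a)) :
    IsOpen (⋂ (a) (_ : P a), f a) ∧ Convex ℝ (⋂ (a) (_ : P a), f a) :=
  ⟨isOpen_iInter_of_finite fun a => isOpen_iInter_of_finite fun _ => (h a).1,
    convex_iInter fun a => convex_iInter fun _ => (h a).2⟩

/-- A finite intersection of open half-spaces. Convexity gives connectedness here, and again for the
slices of `H` by complex lines. -/
lemma isOpen_convex_H : IsOpen (H N) ∧ Convex ℝ (H N) := by
  have h : H N = (⋂ (J : Finset (T N)) (_ : J.Nonempty), {s | formC1 J (rePart s) < 0}) ∩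
      ((⋂ (K : Finset (T N)) (_ : 2 ≤ K.card), {s | 0 < formC2 K (rePart s)}) ∩
      ((⋂ (J : Finset (T N)) (_ : J.Nonempty), {s | 0 < formC4First J (rePart s)}) ∩
      ((⋂ (J : Finset (T N)) (_ : J.Nonempty), {s | 0 < formC4Last J (rePart s)}) ∩
      ⋂ (v : Var N) (_ : True), {s | 0 < formC6 v (rePart s)}))) := by
    ext s
    simp only [H, Set.mem_inter_iff, Set.mem_iInter, Set.mem_ofPred_eq, forall_true_left]
  have h1 := isOpen_convex_iInter (P := fun J : Finset (T N) => J.Nonempty) fun J => by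
    have := isOpen_convex_neg (J.card : ℤ) (varsC1 J)
    simpa only [← formC1_eq] using this
  have h2 := isOpen_convex_iInter (P := fun K : Finset (T N) => 2 ≤ K.card) fun K => by
    have := isOpen_convex_pos (K.card - 1 : ℤ) (varsC2 K)
    simpa only [← formC2_eq] using this
  have h3 := isOpen_convex_iInter (P := fun J : Finset (T N) => J.Nonempty) fun J => by
    have := isOpen_convex_pos (J.card : ℤ) (varsC4First J)
    simpa only [← formC4First_eq] using this
  have h4 := isOpen_convex_iInter (P := fun J : Finset (T N) => J.Nonempty) fun J => by
    have := isOpen_convex_pos (J.card : ℤ) (varsC4Last J)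
    simpa only [← formC4Last_eq] using this
  have h5 : IsOpen (⋂ (v : Var N) (_ : True), {s | 0 < formC6 v (rePart s)}) ∧
      Convex ℝ (⋂ (v : Var N) (_ : True), {s | 0 < formC6 v (rePart s)}) :=
    isOpen_convex_iInter fun v => by
      have := isOpen_convex_pos 1 {v}
      simpa [formC6] using this
  rw [h]
  exact ⟨h1.1.inter (h2.1.inter (h3.1.inter (h4.1.inter h5.1))),
    h1.2.inter (h2.2.inter (h3.2.inter (h4.2.inter h5.2)))⟩

lemma H_nonempty : (H N).Nonempty := by
  -- With exponents `0` on the pairs and a common value `a` elsewhere, the conditions become `1 + 2a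
  -- < 0` and `1 + a > 0`; any `a` strictly between `-1` and `-1/2` works.
  refine ⟨Sum.elim (fun _ => ((-2 / 3 : ℝ) : ℂ)) (Sum.elim (fun _ => ((-2 / 3 : ℝ) : ℂ))
    fun _ => 0), fun J hJ => ?_, fun K hK => ?_, fun J hJ => ?_, fun J hJ => ?_, fun v => ?_⟩
  · have : (0 : ℝ) < J.card := by exact_mod_cast Finset.card_pos.2 hJ
    simp only [formC1, rePart, Sum.elim_inl, Sum.elim_inr, Complex.ofReal_re, Complex.zero_re,
      Finset.sum_const_zero, Finset.sum_const, nsmul_eq_mul]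
    linarith
  · have : (2 : ℝ) ≤ K.card := by exact_mod_cast hK
    simp only [formC2, rePart, Sum.elim_inr, Complex.zero_re, Finset.sum_const_zero]
    linarith
  · have : (0 : ℝ) < J.card := by exact_mod_cast Finset.card_pos.2 hJ
    simp only [formC4First, rePart, Sum.elim_inl, Sum.elim_inr, Complex.ofReal_re,
      Complex.zero_re, Finset.sum_const_zero, Finset.sum_const, nsmul_eq_mul]
    linarith
  · have : (0 : ℝ) < J.card := by exact_mod_cast Finset.card_pos.2 hJ
    simp only [formC4Last, rePart, Sum.elim_inl, Sum.elim_inr, Complex.ofReal_re,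
      Complex.zero_re, Finset.sum_const_zero, Finset.sum_const, nsmul_eq_mul]
    linarith
  · rcases v with i | i | e <;>
      simp only [formC6, rePart, Sum.elim_inl, Sum.elim_inr, Complex.ofReal_re,
        Complex.zero_re] <;> norm_num

lemma not_mem_hyperplanes {s : Var N → ℂ} (hs : s ∈ H N) : rePart s ∉ hyperplanes N := by
  obtain ⟨h1, h2, h3, h4, h5⟩ := hs
  simp only [hyperplanes, Set.mem_union, Set.mem_iUnion, Set.mem_ofPred_eq, not_or, not_exists]
  exact ⟨⟨⟨⟨fun J hJ => (h1 J hJ).ne, fun K hK => (h2 K hK).ne'⟩, fun J hJ => (h3 J hJ).ne'⟩,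
    fun J hJ => (h4 J hJ).ne'⟩, fun v => (h5 v).ne'⟩

end Region

/-! ### From real to complex exponents. -/

section Continuation

variable (p : ℕ) [hp : Fact p.Prime] {N : ℕ}

lemma analyticAt_evalPow (P : MvPolynomial (Var N) ℚ) (s : Var N → ℂ) :
    AnalyticAt ℂ (evalPow p P) s := by
  have hp0 : (p : ℂ) ≠ 0 := by exact_mod_cast hp.1.ne_zero
  unfold evalPow
  induction P using MvPolynomial.induction_on with
  | C a =>
    simp only [MvPolynomial.aeval_C]
    exact analyticAt_const
  | add P Q hP hQ =>
    simp only [map_add]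
    exact hP.add hQ
  | mul_X P v hP =>
    simp only [map_mul, MvPolynomial.aeval_X]
    have hv : AnalyticAt ℂ (fun s : Var N → ℂ => s v) s :=
      (ContinuousLinearMap.proj (R := ℂ) (φ := fun _ : Var N => ℂ) v).analyticAt s
    have hexp : AnalyticAt ℂ (fun s : Var N → ℂ => (p : ℂ) ^ (-s v)) s := by
      simp only [Complex.cpow_def_of_ne_zero hp0]
      exact (analyticAt_const.mul hv.neg).cexp
    exact hP.mul hexp

lemma differentiable_evalPow (P : MvPolynomial (Var N) ℚ) :
    Differentiable ℂ (evalPow p P) := fun s => (analyticAt_evalPow p P s).differentiableAt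

/-- The logarithm of the integrand, as a linear function of the exponents. -/
noncomputable def logIntegrand (τ : Var N → ℝ) (x : T N → ℚ_[p]) : ℝ :=
  ∑ v, τ v * Real.log ‖factor p v x‖

lemma integrand_line (σ τ : Var N → ℝ) (z : ℂ) {x : T N → ℚ_[p]} (hx : x ∉ divisor p N) :
    integrand p N (fun v => σ v + z * τ v) x =
      ((absIntegrand p σ x).toReal : ℂ) * Complex.exp (z * logIntegrand p τ x) := by
  rw [mem_divisor_iff] at hx
  push Not at hx
  rw [integrand_eq_prod, absIntegrand_eq_prod, ENNReal.toReal_prod, logIntegrand,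
    Complex.ofReal_sum, Finset.mul_sum, Complex.exp_sum, Complex.ofReal_prod,
    ← Finset.prod_mul_distrib]
  refine Finset.prod_congr rfl fun v _ => ?_
  have h0 : ((‖factor p v x‖ : ℝ) : ℂ) ≠ 0 := by
    exact_mod_cast norm_ne_zero_iff.2 (hx v)
  rw [toReal_normPow p (hx v), Complex.cpow_add _ _ h0, Complex.ofReal_cpow (norm_nonneg _),
    Complex.cpow_def_of_ne_zero h0 (z * τ v), ← Complex.ofReal_log (norm_nonneg _)]
  congr 2
  push_cast
  ring

/-- The zeta integral at a real point. -/
lemma zeta_ofReal (σ : Var N → ℝ) :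
    zeta p N (fun v => (σ v : ℂ)) = ((∫⁻ x, absIntegrand p σ x ∂haar p N).toReal : ℂ) := by
  rw [← setLIntegral_absIntegrand, ← integral_toReal
    (measurable_absIntegrand p σ).aemeasurable
    (Eventually.of_forall fun x => (absIntegrand_ne_top p σ x).lt_top), ← integral_complex_ofReal]
  refine setIntegral_congr_fun (measurableSet_divisor p).compl fun x hx => ?_
  simpa using integrand_line p σ 0 0 hx

/-- The measure with density `absIntegrand`. -/
noncomputable def weightedHaar (σ : Var N → ℝ) : Measure (T N → ℚ_[p]) :=
  ((haar p N).restrict (divisor p N)ᶜ).withDensity (absIntegrand p σ)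

/-- Along the line the integrand is `absIntegrand` at `σ` times `exp (z · logIntegrand)`, so the
differentiability of `complexMGF` replaces a differentiation under the integral sign. -/
lemma zeta_line (σ τ : Var N → ℝ) (z : ℂ) :
    zeta p N (fun v => σ v + z * τ v) =
      ProbabilityTheory.complexMGF (logIntegrand p τ) (weightedHaar p σ) z := by
  rw [ProbabilityTheory.complexMGF, weightedHaar, integral_withDensity_eq_integral_toReal_smul
    (measurable_absIntegrand p σ)
    (Eventually.of_forall fun x => (absIntegrand_ne_top p σ x).lt_top)]
  refine setIntegral_congr_fun (measurableSet_divisor p).compl fun x hx => ?_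
  simpa using integrand_line p σ τ z hx

lemma mem_integrableExpSet {σ τ : Var N → ℝ} {t : ℝ}
    (ht : (fun v => (σ v + (t : ℂ) * τ v : ℂ)) ∈ H N) :
    t ∈ ProbabilityTheory.integrableExpSet (logIntegrand p τ) (weightedHaar p σ) := by
  have h := (integrableOn_integrand p ht).norm
  change Integrable _ _
  rw [weightedHaar, integrable_withDensity_iff_integrable_smul' (measurable_absIntegrand p σ)
    (Eventually.of_forall fun x => (absIntegrand_ne_top p σ x).lt_top)]
  refine h.congr ?_
  filter_upwards [ae_restrict_mem (measurableSet_divisor p).compl] with x hx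
  rw [integrand_line p σ τ t hx, norm_mul, Complex.norm_real, Complex.norm_exp]
  simp

/-- A rational expression for the zeta integral at the real points of `H(ℂ)` holds on the whole
of `H(ℂ)`. -/
lemma zeta_mul_evalPow_eq {P Q : MvPolynomial (Var N) ℚ}
    (h : ∀ σ ∈ HReal N, (∫⁻ x, absIntegrand p σ x ∂haar p N).toReal * realEvalPow p Q σ =
      realEvalPow p P σ) {s : Var N → ℂ} (hs : s ∈ H N) :
    zeta p N s * evalPow p Q s = evalPow p P s := by
  -- The line through `s` in the imaginary direction: `z = i` gives `s`, and real `z` give real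
  -- exponents.
  set σ : Var N → ℝ := fun v => (s v).re with hσ
  set τ : Var N → ℝ := fun v => (s v).im with hτ
  set L : ℂ → Var N → ℂ := fun z v => σ v + z * τ v with hL
  have hLc : Differentiable ℂ L := by
    rw [hL]; fun_prop
  set U : Set ℂ := L ⁻¹' H N with hU
  have hUo : IsOpen U := isOpen_convex_H.1.preimage hLc.continuous
  have hUc : Convex ℝ U := by
    intro z hz w hw a b ha hb hab
    have : L (a • z + b • w) = a • L z + b • L w := by
      funext v
      have hab' : (a : ℂ) + b = 1 := by exact_mod_cast hab
      simp only [hL, Pi.add_apply, Pi.smul_apply, Complex.real_smul]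
      linear_combination -(σ v : ℂ) * hab'
    rw [hU, Set.mem_preimage, this]
    exact isOpen_convex_H.2 hz hw ha hb hab
  -- Membership in `H` depends on real parts only, so `U` is invariant under vertical translations;
  -- with `i` it contains `0`.
  have hre : ∀ z, L z ∈ H N ↔ L (z.re : ℂ) ∈ H N := by
    intro z
    rw [← rePart_mem_HReal, ← rePart_mem_HReal (s := L (z.re : ℂ))]
    have : rePart (L z) = rePart (L (z.re : ℂ)) := by
      funext v
      simp [rePart, hL]
    rw [this]
  have hI : L Complex.I = s := by
    funext v
    simp only [hL, hσ, hτ]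
    rw [mul_comm]
    exact Complex.re_add_im (s v)
  have hreal : ∀ t : ℝ, L t ∈ H N → zeta p N (L t) * evalPow p Q (L t) = evalPow p P (L t) := by
    intro t ht
    have hLt : L t = fun v => ((σ v + t * τ v : ℝ) : ℂ) := by
      funext v
      simp [hL]
    rw [hLt] at ht ⊢
    rw [zeta_ofReal, evalPow_ofReal, evalPow_ofReal, ← h _ ht]
    push_cast
    rfl
  have hzeta : DifferentiableOn ℂ (fun z => zeta p N (L z)) U := by
    have h1 : (fun z => zeta p N (L z)) =
        ProbabilityTheory.complexMGF (logIntegrand p τ) (weightedHaar p σ) :=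
      funext fun z => zeta_line p σ τ z
    rw [h1]
    refine ProbabilityTheory.differentiableOn_complexMGF.mono fun z hz => ?_
    have hopen : IsOpen {t : ℝ | L t ∈ H N} :=
      isOpen_convex_H.1.preimage (hLc.continuous.comp Complex.continuous_ofReal)
    exact interior_mono (fun t ht => mem_integrableExpSet p ht)
      (hopen.interior_eq.symm ▸ (hre z).1 hz)
  have hf : AnalyticOnNhd ℂ (fun z => zeta p N (L z) * evalPow p Q (L z)) U :=
    (hzeta.mul ((differentiable_evalPow p Q).comp hLc).differentiableOn).analyticOnNhd hUo
  have hg : AnalyticOnNhd ℂ (fun z => evalPow p P (L z)) U :=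
    ((differentiable_evalPow p P).comp hLc).differentiableOn.analyticOnNhd hUo
  have hIU : Complex.I ∈ U := by rw [hU, Set.mem_preimage, hI]; exact hs
  have h0U : (0 : ℂ) ∈ U := by
    have := (hre Complex.I).1 hIU
    rw [Complex.I_re, Complex.ofReal_zero] at this
    exact this
  -- The real `z` near `0` accumulate at `0`, which is enough for the identity theorem on the convex
  -- set `U`.
  have hfreq : ∃ᶠ z in 𝓝[≠] (0 : ℂ),
      zeta p N (L z) * evalPow p Q (L z) = evalPow p P (L z) := by
    have htend : Tendsto (fun t : ℝ => (t : ℂ)) (𝓝[≠] 0) (𝓝[≠] 0) := by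
      refine tendsto_nhdsWithin_of_tendsto_nhds_of_eventually_within _ ?_ ?_
      · exact (Complex.continuous_ofReal.tendsto' 0 0 (by simp)).mono_left nhdsWithin_le_nhds
      · filter_upwards [self_mem_nhdsWithin] with t ht
        simpa using ht
    refine htend.frequently (Eventually.frequently ?_)
    have : ∀ᶠ t : ℝ in 𝓝 0, L t ∈ H N :=
      (isOpen_convex_H.1.preimage (hLc.continuous.comp Complex.continuous_ofReal)).mem_nhds
        (by rw [Set.mem_preimage, Function.comp_apply, Complex.ofReal_zero]; exact h0U)
    exact (this.filter_mono nhdsWithin_le_nhds).mono fun t ht => hreal t ht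
  have := hf.eqOn_of_preconnected_of_frequently_eq hg hUc.isPreconnected h0U hfreq hIU
  simpa only [hI] using this

end Continuation

/-! ### Divergence for non-negative exponents. -/

section Divergence

variable (p : ℕ) [hp : Fact p.Prime] {N : ℕ}

lemma one_le_normPow {t : ℝ} (ht : 0 ≤ t) {x : ℚ_[p]} (hx : 1 ≤ ‖x‖) : 1 ≤ normPow t x := by
  have h0 : x ≠ 0 := by rintro rfl; simp at hx; linarith
  rw [normPow_of_ne h0]
  have h1 : 1 ≤ ‖x‖ₑ := by
    rw [← ofReal_norm, ← ENNReal.ofReal_one]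
    exact ENNReal.ofReal_le_ofReal hx
  simpa using ENNReal.rpow_le_rpow h1 ht

lemma padicHaar_univ : padicHaar p Set.univ = ⊤ := by
  refine ENNReal.eq_top_of_forall_nnreal_le fun r => ?_
  obtain ⟨n, hn⟩ := pow_unbounded_of_one_lt r (by exact_mod_cast hp.1.one_lt : (1 : NNReal) < p)
  calc (r : ℝ≥0∞) ≤ (p : ℝ≥0∞) ^ (n : ℤ) := by
        rw [zpow_natCast]; exact_mod_cast hn.le
    _ = padicHaar p (Metric.closedBall 0 ((p : ℝ) ^ (n : ℤ))) :=
        (padicHaar_closedBall_zpow n).symm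
    _ ≤ padicHaar p Set.univ := measure_mono (Set.subset_univ _)

/-- The integral diverges if all exponents are non-negative. -/
lemma lintegral_absIntegrand_eq_top (hN : 4 ≤ N) {σ : Var N → ℝ} (hσ : ∀ v, 0 ≤ σ v) :
    ∫⁻ x, absIntegrand p σ x ∂haar p N = ⊤ := by
  have hp1 : (1 : ℝ) < p := by exact_mod_cast hp.1.one_lt
  -- `T` is non-empty as `N ≥ 4`; this coordinate will be unbounded and carry the infinite volume.
  let i₀ : T N := ⟨2, by simp; omega⟩
  -- a box of infinite volume whose points have distinct absolute values greater than `1`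
  let A : T N → Set ℚ_[p] := fun i =>
    if i = i₀ then {x | (p : ℝ) ^ N < ‖x‖} else {x | ‖x‖ = (p : ℝ) ^ (i : ℕ)}
  have hA0 : A i₀ = (Metric.closedBall 0 ((p : ℝ) ^ N))ᶜ := by
    ext x
    simp [A]
  have hAm : ∀ i, MeasurableSet (A i) := by
    intro i
    by_cases hi : i = i₀
    · rw [hi, hA0]
      exact Metric.isClosed_closedBall.measurableSet.compl
    · simp only [A, hi, if_false]
      exact (isClosed_eq continuous_norm continuous_const).measurableSet
  have hAtop : padicHaar p (A i₀) = ⊤ := by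
    rw [hA0, measure_compl Metric.isClosed_closedBall.measurableSet
      (isCompact_closedBall _ _).measure_lt_top.ne, padicHaar_univ]
    exact ENNReal.top_sub (isCompact_closedBall _ _).measure_lt_top.ne
  have hApos : ∀ i, i ≠ i₀ → padicHaar p (A i) ≠ 0 := by
    intro i hi
    have hAi : A i = Metric.sphere 0 ((p : ℝ) ^ (i : ℕ)) := by
      ext x
      simp [A, hi]
    rw [hAi]
    refine (IsOpen.measure_pos _ (IsUltrametricDist.isOpen_sphere _ (by positivity)) ?_).ne'
    refine ⟨((p : ℚ_[p]) ^ (i : ℕ))⁻¹, ?_⟩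
    simp
  have hvol : haar p N (Set.univ.pi A) = ⊤ := by
    rw [haar, Measure.pi_pi, ← Finset.mul_prod_erase _ _ (Finset.mem_univ i₀), hAtop]
    exact ENNReal.top_mul (Finset.prod_ne_zero_iff.2 fun i hi =>
      hApos i (Finset.ne_of_mem_erase hi))
  have hnorm : ∀ x ∈ Set.univ.pi A, ∀ i, 1 < ‖x i‖ := by
    intro x hx i
    have hxi := hx i (Set.mem_univ i)
    by_cases hi : i = i₀
    · simp only [A, hi, if_true, Set.mem_ofPred_eq] at hxi
      rw [hi]
      exact (one_le_pow₀ hp1.le).trans_lt hxi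
    · simp only [A, hi, if_false, Set.mem_ofPred_eq] at hxi
      rw [hxi]
      have : 2 ≤ (i : ℕ) := (Finset.mem_Icc.1 i.2).1
      exact one_lt_pow₀ hp1 (by omega)
  have hdist : ∀ x ∈ Set.univ.pi A, ∀ i j, i ≠ j → ‖x i‖ ≠ ‖x j‖ := by
    intro x hx i j hij
    have hlt : ∀ j, j ≠ i₀ → ‖x j‖ < ‖x i₀‖ := by
      intro j hj
      have h1 := hx i₀ (Set.mem_univ _)
      have h2 := hx j (Set.mem_univ _)
      simp only [A, hj, if_true, if_false, Set.mem_ofPred_eq] at h1 h2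
      rw [h2]
      -- The other coordinates have norm `p^j` with `j ≤ N - 2`, below the threshold `p^N` for `i₀`.
      refine lt_of_le_of_lt (pow_le_pow_right₀ hp1.le ?_) h1
      have := (Finset.mem_Icc.1 j.2).2
      omega
    by_cases hi : i = i₀
    · rw [hi]
      exact (hlt j fun h => hij (hi.trans h.symm)).ne'
    by_cases hj : j = i₀
    · rw [hj]
      exact (hlt i hi).ne
    have h1 := hx i (Set.mem_univ _)
    have h2 := hx j (Set.mem_univ _)
    simp only [A, hi, hj, if_false, Set.mem_ofPred_eq] at h1 h2
    rw [h1, h2]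
    intro h
    exact hij (Subtype.ext (pow_right_injective₀ (by positivity) hp1.ne' h))
  -- By the ultrametric inequality the difference of two elements of distinct norms has the larger
  -- norm, here greater than `1`.
  have hfac : ∀ x ∈ Set.univ.pi A, ∀ v, 1 ≤ ‖factor p v x‖ := by
    intro x hx v
    rcases v with i | i | e
    · exact (hnorm x hx i).le
    · change 1 ≤ ‖1 - x i‖
      have := hnorm x hx i
      rw [sub_eq_add_neg, Padic.add_eq_max_of_ne (by rw [norm_neg, norm_one]; exact this.ne)]
      simp
    · change 1 ≤ ‖x e.1.1 - x e.1.2‖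
      rw [sub_eq_add_neg, Padic.add_eq_max_of_ne
        (by rw [norm_neg]; exact hdist x hx _ _ e.2.ne)]
      exact (hnorm x hx _).le.trans (le_max_left _ _)
  rw [eq_top_iff, ← hvol, ← lintegral_indicator_one (MeasurableSet.univ_pi hAm)]
  refine lintegral_mono fun x => ?_
  by_cases hx : x ∈ Set.univ.pi A
  · rw [Set.indicator_of_mem hx, absIntegrand_eq_prod]
    exact Finset.one_le_prod' fun v _ => one_le_normPow p (hσ v) (hfac x hx v)
  · rw [Set.indicator_of_notMem hx]
    exact zero_le

end Divergence

end StringZeta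


/-! ### The main theorem. -/

theorem mainTheorem1 (p : ℕ) [Fact p.Prime] (N : ℕ) (hN : 4 ≤ N) :
    -- `H(ℂ)` is a non-empty open connected subset of `ℂ^D`
    (IsOpen (StringZeta.H N) ∧ IsConnected (StringZeta.H N)) ∧
    -- on it the integral converges absolutely and is a holomorphic function
    (∀ s ∈ StringZeta.H N,
      IntegrableOn (StringZeta.integrand p N s) (StringZeta.divisor p N)ᶜ
        (StringZeta.haar p N)) ∧
    DifferentiableOn ℂ (StringZeta.zeta p N) (StringZeta.H N) ∧
    -- continuation to `ℂ^D` as a rational function of the `p^{-s_{ij}}`, and its poles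
    (∃ P Q : MvPolynomial (StringZeta.Var N) ℚ, Q ≠ 0 ∧
      (∀ s ∈ StringZeta.H N, StringZeta.evalPow p Q s ≠ 0 ∧
        StringZeta.zeta p N s = StringZeta.evalPow p P s / StringZeta.evalPow p Q s) ∧
      (∀ s : StringZeta.Var N → ℂ, StringZeta.IsPole p P Q s →
        StringZeta.rePart s ∈ StringZeta.hyperplanes N)) ∧
    -- divergence to `+∞` for non-negative real parts
    (∀ s : StringZeta.Var N → ℂ, (∀ v, 0 ≤ (s v).re) →
      ∫⁻ x in (StringZeta.divisor p N)ᶜ, ‖StringZeta.integrand p N s x‖ₑ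
        ∂(StringZeta.haar p N) = ⊤) := by
  open StringZeta in
  obtain ⟨hopen, hconv⟩ := isOpen_convex_H (N := N)
  obtain ⟨P, Q, hQ, hPQ⟩ := lintegral_absIntegrand_mem p (N := N)
  have hQ0 : ∀ s ∈ H N, evalPow p Q s ≠ 0 := fun s hs h =>
    not_mem_hyperplanes hs (hQ s h)
  have hzeta : ∀ s ∈ H N, zeta p N s = evalPow p P s / evalPow p Q s := fun s hs =>
    (eq_div_iff (hQ0 s hs)).2 (zeta_mul_evalPow_eq p (fun σ hσ => hPQ ⟨σ, hσ⟩) hs)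
  refine ⟨⟨hopen, H_nonempty, hconv.isPreconnected⟩, fun s hs => integrableOn_integrand p hs,
    ?_, ⟨P, Q, ?_, fun s hs => ⟨hQ0 s hs, hzeta s hs⟩, ?_⟩, ?_⟩
  -- Joint holomorphy is inherited from the quotient `P/Q`, whose denominator has no zero on `H`.
  · intro s hs
    exact (((analyticAt_evalPow p P s).div (analyticAt_evalPow p Q s)
      (hQ0 s hs)).differentiableAt.differentiableWithinAt).congr hzeta (hzeta s hs)
  · rintro rfl
    obtain ⟨s, hs⟩ := H_nonempty (N := N)
    exact hQ0 s hs (by simp [evalPow])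
  · intro s hs
    by_contra hns
    -- Off the hyperplanes `Q` does not vanish, so `P/Q` is its own holomorphic extension.
    exact hs ⟨_, (analyticAt_evalPow p P s).div (analyticAt_evalPow p Q s) fun h => hns (hQ s h),
      Eventually.of_forall fun _ _ => rfl⟩
  · intro s hs
    rw [lintegral_enorm_integrand]
    exact lintegral_absIntegrand_eq_top p hN hs
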